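/- **Setting.** Let $\langle(z_1,w_1),(z_2,w_2)\rangle=\operatorname{Re}(z_1\bar z_2-w_1\bar w_2)$ on $\mathbb C^2$, let $L=\{(z,w):|z|<|w|\}$, and let $G=\{(z,w):|z|^2-|w|^2=-1\}$, identified with $SU(1,1)$ by letting $(z,w)$ correspond to the matrix $\begin{pmatrix}\bar w&z\\ \bar z&w\end{pmatrix}$; such matrices act on the unit disc $\mathbb D$ by linear fractional maps. The universal covers are $\tilde L=\{(z,\alpha,r)\in\mathbb C\times\mathbb R\times\mathbb R_+:|z|<r\}$ and $\tilde G=\{(z,\alpha,r)\in\tilde L: r^2-|z|^2=1\}$, with covering map $\pi(z,\alpha,r)=(z,re^{i\alpha})$. $\tilde G$ is a Lie group with unit $e=(0,0,1)$ and carries the Lorentz metric induced by $\langle\cdot,\cdot\rangle$; let $\theta:\tilde L\to\tilde G$, $\theta(z,\alpha,r)=(\lambda^{-1}z,\alpha,\lambda^{-1}r)$ with $\lambda=\sqrt{r^2-|z|^2}$. The group $\tilde G\times\tilde G$ acts on $\tilde G$ and (by lifting matrix multiplication) on $\tilde L$ by $(g,h)\cdot x=gxh^{-1}$. Let $Z$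 be the centre of $\tilde G$, so that $\tilde G/Z=PSU(1,1)$. **Condition (\*).** $\Gamma_1$ is a discrete subgroup and $\Gamma_2$ a discrete cyclic subgroup of $\tilde G$, both of finite level $k\ge1$, i.e. $\Gamma_i\cap Z$ has index $k$ in $Z$. The point $u\in\mathbb D$ is fixed by a nontrivial element of the image $\overline\Gamma_i$ of $\Gamma_i$ in $PSU(1,1)$, for $i=1$ and for $i=2$. Let $p_i$ be the order of the isotropy group of $u$ in $\overline\Gamma_i$ and $p=\operatorname{lcm}(p_1,p_2)$; then $p>k$. **Construction.** For $g\in\tilde G$ let $I_g$ be the connected component containing $g$ of $\{a\in\tilde L:\langle\pi(g),\pi(a)\rangle\le-1\}$, and let $H_g$ be the closure of $\tilde L\setminus I_g$. For $x\in\Gamma_1(u)$ let $Q_x=\bigcap H_{g_1g_2}$ over all $g_1\in\Gamma_1$, $g_2\in\Gamma_2$ with $g_1(u)=x$. Let $P=\bigcup_{x\in\Gamma_1(u)}Q_x$, let $\partial P$ be its boundary in $\tilde L$, let $F_g=\mathrm{Cl}(\mathrm{Int}(\partial H_g\cap\partial P))$ with interior and closure taken in $\partial P$, and let $\mathcal F_g=\theta(F_g)$.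 Write $\Gamma_1\Gamma_2=\{g_1g_2: g_1\in\Gamma_1,\ g_2\in\Gamma_2\}\subset\tilde G$. **Theorem A.** Assume (\*). Then: 1. $\partial P$ is invariant under $\Gamma_1\times\Gamma_2$, and $(g_1,g_2)\cdot F_g=F_{g_1gg_2^{-1}}$ for all $(g_1,g_2)\in\Gamma_1\times\Gamma_2$ and $g\in\tilde G$. 2. For $g\in\Gamma_1\Gamma_2$ the set $F_g$ is a fundamental domain for the action of $\Gamma_1\times\Gamma_2$ on $\partial P$, in the following sense. It is closed in $\partial P$; its translates are the sets $F_h$ with $h\in\Gamma_1\Gamma_2$; they cover $\partial P$, and the union of their interiors is dense in $\partial P$; and the interior of $F_g$ does not meet $\gamma\cdot F_g$ for any $\gamma=(g_1,g_2)\in\Gamma_1\times\Gamma_2$ with $g_1gg_2^{-1}\neq g$ (so $\mathrm{Int}(F_g)\cap F_h=\emptyset$ for $h\ne g$ in $\Gamma_1\Gamma_2$). If $\Gamma_1\cap\Gamma_2\subset Z$, then the interior of $F_g$ does not meet $\gamma\cdot F_g$ for any $\gamma\in\Gamma_1\times\Gamma_2$ that acts nontrivially on $\partial P$. 3. The family $(F_g)_{g\in\Gamma_1\Gamma_2}$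 is locally finite in $\partial P$. 4. The restriction of $\theta$ is a $\Gamma_1\times\Gamma_2$-equivariant homeomorphism $\partial P\to\tilde G$. 5. For $g\in\Gamma_1\Gamma_2$ the set $\mathcal F_g$ is a fundamental domain for the action of $\Gamma_1\times\Gamma_2$ on $\tilde G$, in the same sense as in 2 (including the addition for $\Gamma_1\cap\Gamma_2\subset Z$), and the family $(\mathcal F_g)_{g\in\Gamma_1\Gamma_2}$ is locally finite in $\tilde G$. 6. If $g_1,h_1\in\Gamma_1$, $g_2,h_2\in\Gamma_2$ and $g_1g_2\ne h_1h_2$, then $\mathcal F_{g_1g_2}\cap\mathcal F_{h_1h_2}$ lies in a two-dimensional totally geodesic submanifold of $\tilde G$ (a smooth embedded surface, whose induced metric may be degenerate, such that every geodesic of $\tilde G$ tangent to it at a point stays in it for a short time). -/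

import Mathlib

open scoped ComplexConjugate Pointwise Topology ContDiff
open Complex.UnitDisc

noncomputable section

namespace LorentzDomains

/-! ### The pseudo-Euclidean space, the quadric and the cone -/

/-- The symmetric bilinear form of signature `(2,2)` on `ℂ²`. -/
def form (a b : ℂ × ℂ) : ℝ := (a.1 * conj b.1 - a.2 * conj b.2).re

/-- The cone `L` of all `(z, w)` with `|z| < |w|`. -/
def coneL : Set (ℂ × ℂ) := {a | ‖a.1‖ < ‖a.2‖}

/-- The universal cover of the cone `L`: triples `(z, α, r)` with `|z| < r`.
The covering map is `(z, α, r) ↦ (z, r e^{iα})`. -/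
structure LTilde where
  /-- the first complex coordinate -/
  z : ℂ
  /-- the argument of the second complex coordinate -/
  arg : ℝ
  /-- the modulus of the second complex coordinate -/
  r : ℝ
  /-- the point lies over the cone -/
  norm_lt : ‖z‖ < r

namespace LTilde

/-- The topology of a subspace of `ℂ × ℝ × ℝ`. -/
instance : TopologicalSpace LTilde :=
  TopologicalSpace.induced (fun a => (a.z, a.arg, a.r)) inferInstance

/-- The second complex coordinate `w = r e^{iα}` of the image in the cone. -/
def w (a : LTilde) : ℂ := a.r * Complex.exp (a.arg * Complex.I)

/-- The covering map `π` from `LTilde` to `L ⊆ ℂ²`. -/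
def proj (a : LTilde) : ℂ × ℂ := (a.z, a.w)

theorem r_pos (a : LTilde) : 0 < a.r := (norm_nonneg a.z).trans_lt a.norm_lt

theorem norm_w (a : LTilde) : ‖a.w‖ = a.r := by
  rw [w, norm_mul, Complex.norm_exp_ofReal_mul_I, mul_one, Complex.norm_real, Real.norm_eq_abs,
    abs_of_pos a.r_pos]

theorem w_ne_zero (a : LTilde) : a.w ≠ 0 := by
  rw [← norm_ne_zero_iff, a.norm_w]; exact a.r_pos.ne'

theorem proj_mem (a : LTilde) : a.proj ∈ coneL := by
  change ‖a.z‖ < ‖a.w‖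
  rw [a.norm_w]; exact a.norm_lt

/-- A point over the cone is determined by its image in `L`, if its argument is known up to an
error less than `2π`. -/
theorem eq_of {a b : LTilde} (hz : a.z = b.z) (hw : a.w = b.w)
    (h : |a.arg - b.arg| < 2 * Real.pi) : a = b := by
  have hr : a.r = b.r := by rw [← a.norm_w, ← b.norm_w, hw]
  have harg : a.arg = b.arg := by
    have h1 : Complex.exp (a.arg * Complex.I) = Complex.exp (b.arg * Complex.I) := by
      have h2 := hw
      rw [w, w, hr] at h2
      exact mul_left_cancel₀ (Complex.ofReal_ne_zero.2 b.r_pos.ne') h2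
    obtain ⟨n, hn⟩ := Complex.exp_eq_exp_iff_exists_int.1 h1
    have h3 : a.arg = b.arg + n * (2 * Real.pi) := by
      have := congrArg Complex.im hn
      simpa using this
    have h4 : |(n : ℝ)| * (2 * Real.pi) < 2 * Real.pi := by
      rw [← abs_of_pos Real.two_pi_pos, ← abs_mul, abs_of_pos Real.two_pi_pos]
      rwa [h3, add_sub_cancel_left] at h
    have h5 : |(n : ℝ)| < 1 := by nlinarith [Real.two_pi_pos]
    have h6 : |n| < 1 := by exact_mod_cast h5
    rw [h3, Int.abs_lt_one_iff.1 h6]; simp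
  cases a; cases b; simp_all

/-- The number `1 + z̄₁ z₂ / (w₁ w₂)`; it has positive real part. -/
def twist (a b : LTilde) : ℂ := 1 + conj a.z * b.z / (a.w * b.w)

theorem twist_re_pos (a b : LTilde) : 0 < (twist a b).re := by
  have h : ‖conj a.z * b.z / (a.w * b.w)‖ < 1 := by
    rw [norm_div, norm_mul, norm_mul, a.norm_w, b.norm_w, Complex.norm_conj,
      div_lt_one (mul_pos a.r_pos b.r_pos)]
    exact mul_lt_mul'' a.norm_lt b.norm_lt (norm_nonneg _) (norm_nonneg _)
  have h2 := (abs_le.1 (Complex.abs_re_le_norm (conj a.z * b.z / (a.w * b.w)))).1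
  rw [twist, Complex.add_re, Complex.one_re]
  linarith

theorem abs_arg_twist (a b : LTilde) : |(twist a b).arg| < Real.pi / 2 :=
  Complex.abs_arg_lt_pi_div_two_iff.2 (Or.inl (twist_re_pos a b))

theorem twist_eq (a b : LTilde) : a.w * b.w * twist a b = a.w * b.w + conj a.z * b.z := by
  have := a.w_ne_zero
  have := b.w_ne_zero
  rw [twist]; field_simp

theorem normSq_mul (z₁ w₁ z₂ w₂ : ℂ) :
    Complex.normSq (w₁ * w₂ + conj z₁ * z₂) - Complex.normSq (conj w₁ * z₂ + z₁ * w₂) =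
      (Complex.normSq w₁ - Complex.normSq z₁) * (Complex.normSq w₂ - Complex.normSq z₂) := by
  simp only [Complex.normSq_apply, Complex.add_re, Complex.add_im, Complex.mul_re, Complex.mul_im,
    Complex.conj_re, Complex.conj_im]
  ring

theorem normSq_lt (a : LTilde) : Complex.normSq a.z < Complex.normSq a.w := by
  rw [Complex.normSq_eq_norm_sq, Complex.normSq_eq_norm_sq, a.norm_w]
  exact pow_lt_pow_left₀ a.norm_lt (norm_nonneg _) two_ne_zero

/-- Multiplication of `LTilde`: the lift, with unit `(0, 0, 1)`, of the multiplication of the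
matrices with rows `(w̄, z)` and `(z̄, w)`. -/
instance : Mul LTilde where
  mul a b :=
    { z := conj a.w * b.z + a.z * b.w
      arg := a.arg + b.arg + (twist a b).arg
      r := ‖a.w * b.w + conj a.z * b.z‖
      norm_lt := by
        have h := normSq_mul a.z a.w b.z b.w
        have h2 := mul_pos (sub_pos.2 a.normSq_lt) (sub_pos.2 b.normSq_lt)
        rw [Complex.normSq_eq_norm_sq (_ + conj a.z * b.z),
          Complex.normSq_eq_norm_sq (_ + a.z * b.w)] at h
        exact lt_of_pow_lt_pow_left₀ 2 (norm_nonneg _) (by linarith) }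

instance : One LTilde := ⟨⟨0, 0, 1, by simp⟩⟩

/-- The inverse: the lift of the inverse of matrices. -/
instance : Inv LTilde where
  inv a :=
    { z := -a.z / ((a.r ^ 2 - ‖a.z‖ ^ 2 : ℝ) : ℂ)
      arg := -a.arg
      r := a.r / (a.r ^ 2 - ‖a.z‖ ^ 2)
      norm_lt := by
        have h : 0 < a.r ^ 2 - ‖a.z‖ ^ 2 :=
          sub_pos.2 (pow_lt_pow_left₀ a.norm_lt (norm_nonneg _) two_ne_zero)
        rw [norm_div, norm_neg, Complex.norm_real, Real.norm_eq_abs, abs_of_pos h]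
        exact div_lt_div_of_pos_right a.norm_lt h }

theorem mul_z (a b : LTilde) : (a * b).z = conj a.w * b.z + a.z * b.w := rfl

theorem mul_arg (a b : LTilde) : (a * b).arg = a.arg + b.arg + (twist a b).arg := rfl

theorem mul_w (a b : LTilde) : (a * b).w = a.w * b.w + conj a.z * b.z := by
  have h1 : (a * b).w = (‖a.w * b.w + conj a.z * b.z‖ : ℝ) *
      Complex.exp ((a.arg + b.arg + (twist a b).arg : ℝ) * Complex.I) := rfl
  have h2 : a.w * b.w * twist a b = (a.r * b.r * ‖twist a b‖ : ℝ) *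
      Complex.exp ((a.arg + b.arg + (twist a b).arg : ℝ) * Complex.I) := by
    conv_lhs => rw [← Complex.norm_mul_exp_arg_mul_I (twist a b)]
    simp only [w]
    push_cast
    rw [add_mul, add_mul, Complex.exp_add, Complex.exp_add]
    ring
  rw [h1, ← twist_eq, norm_mul, norm_mul, a.norm_w, b.norm_w, ← h2]

theorem one_z : (1 : LTilde).z = 0 := rfl

theorem one_arg : (1 : LTilde).arg = 0 := rfl

theorem one_w : (1 : LTilde).w = 1 := by
  change (((1 : ℝ) : ℂ)) * Complex.exp (((0 : ℝ) : ℂ) * Complex.I) = 1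
  simp

theorem inv_z (a : LTilde) : a⁻¹.z = -a.z / ((a.r ^ 2 - ‖a.z‖ ^ 2 : ℝ) : ℂ) := rfl

theorem inv_arg (a : LTilde) : a⁻¹.arg = -a.arg := rfl

theorem inv_w (a : LTilde) : a⁻¹.w = conj a.w / ((a.r ^ 2 - ‖a.z‖ ^ 2 : ℝ) : ℂ) := by
  change ((a.r / (a.r ^ 2 - ‖a.z‖ ^ 2) : ℝ) : ℂ) * Complex.exp (((-a.arg : ℝ) : ℂ) * Complex.I) = _
  rw [w, map_mul, Complex.conj_ofReal, ← Complex.exp_conj, map_mul, Complex.conj_I,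
    Complex.conj_ofReal]
  push_cast
  rw [mul_neg, neg_mul]
  ring

/-- `LTilde` is a group. -/
instance : Group LTilde where
  mul_assoc a b c := by
    apply eq_of
    · simp only [mul_z, mul_w, map_add, map_mul, Complex.conj_conj]; ring
    · simp only [mul_z, mul_w, map_add, map_mul, Complex.conj_conj]; ring
    · have h1 := abs_lt.1 (abs_arg_twist a b)
      have h2 := abs_lt.1 (abs_arg_twist (a * b) c)
      have h3 := abs_lt.1 (abs_arg_twist b c)
      have h4 := abs_lt.1 (abs_arg_twist a (b * c))
      simp only [mul_arg]
      rw [abs_lt]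
      constructor <;> linarith
  one_mul a := by
    apply eq_of
    · simp [mul_z, one_z, one_w]
    · simp [mul_w, one_z, one_w]
    · have h1 := abs_lt.1 (abs_arg_twist 1 a)
      have := Real.pi_pos
      rw [mul_arg, one_arg, abs_lt]
      constructor <;> linarith
  mul_one a := by
    apply eq_of
    · simp [mul_z, one_z, one_w]
    · simp [mul_w, one_z, one_w]
    · have h1 := abs_lt.1 (abs_arg_twist a 1)
      have := Real.pi_pos
      rw [mul_arg, one_arg, abs_lt]
      constructor <;> linarith
  inv_mul_cancel a := by
    have h : 0 < a.r ^ 2 - ‖a.z‖ ^ 2 :=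
      sub_pos.2 (pow_lt_pow_left₀ a.norm_lt (norm_nonneg _) two_ne_zero)
    have h' : ((a.r ^ 2 - ‖a.z‖ ^ 2 : ℝ) : ℂ) ≠ 0 := Complex.ofReal_ne_zero.2 h.ne'
    apply eq_of
    · rw [mul_z, inv_z, inv_w, map_div₀, Complex.conj_conj, Complex.conj_ofReal, one_z]
      ring
    · rw [mul_w, inv_z, inv_w, map_div₀, Complex.conj_ofReal, one_w, div_mul_eq_mul_div,
        div_mul_eq_mul_div, ← add_div, div_eq_one_iff_eq h', map_neg, neg_mul, ← sub_eq_add_neg,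
        ← Complex.normSq_eq_conj_mul_self, ← Complex.normSq_eq_conj_mul_self,
        Complex.normSq_eq_norm_sq, Complex.normSq_eq_norm_sq, a.norm_w]
      push_cast
      rfl
    · have h1 := abs_lt.1 (abs_arg_twist a⁻¹ a)
      have := Real.pi_pos
      rw [mul_arg, inv_arg, one_arg, abs_lt]
      constructor <;> linarith

/-- The positive number `r² - |z|²`. -/
def det (a : LTilde) : ℝ := a.r ^ 2 - ‖a.z‖ ^ 2

theorem det_pos (a : LTilde) : 0 < a.det :=
  sub_pos.2 (pow_lt_pow_left₀ a.norm_lt (norm_nonneg _) two_ne_zero)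

theorem det_eq (a : LTilde) : a.det = Complex.normSq a.w - Complex.normSq a.z := by
  rw [Complex.normSq_eq_norm_sq, Complex.normSq_eq_norm_sq, a.norm_w, det]

theorem det_mul (a b : LTilde) : (a * b).det = a.det * b.det := by
  rw [det_eq, det_eq, det_eq, ← normSq_mul, mul_w, mul_z]

theorem det_one : (1 : LTilde).det = 1 := by
  rw [det_eq, one_w, one_z]; simp

/-- The linear fractional action of the matrix with rows `(w̄, z)` and `(z̄, w)` on the open
unit disc. -/
instance : MulAction LTilde 𝔻 where
  smul a x := Complex.UnitDisc.mk ((conj a.w * x + a.z) / (conj a.z * x + a.w)) (by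
    have h := normSq_mul a.z a.w x 1
    have h2 := mul_pos (sub_pos.2 a.normSq_lt) (sub_pos.2 x.normSq_lt_one)
    rw [mul_one, mul_one, Complex.normSq_one] at h
    have h3 : ‖conj a.w * (x : ℂ) + a.z‖ < ‖conj a.z * (x : ℂ) + a.w‖ := by
      rw [add_comm (conj a.z * (x : ℂ))]
      rw [Complex.normSq_eq_norm_sq (_ + conj a.z * _),
        Complex.normSq_eq_norm_sq (_ + a.z)] at h
      exact lt_of_pow_lt_pow_left₀ 2 (norm_nonneg _) (by linarith)
    rw [norm_div, div_lt_one ((norm_nonneg _).trans_lt h3)]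
    exact h3)
  one_smul x := by
    apply Complex.UnitDisc.coe_injective
    change (conj (1 : LTilde).w * (x : ℂ) + (1 : LTilde).z) /
      (conj (1 : LTilde).z * (x : ℂ) + (1 : LTilde).w) = x
    simp [one_w, one_z]
  mul_smul a b x := by
    apply Complex.UnitDisc.coe_injective
    change (conj (a * b).w * (x : ℂ) + (a * b).z) / (conj (a * b).z * (x : ℂ) + (a * b).w) =
      (conj a.w * ((conj b.w * (x : ℂ) + b.z) / (conj b.z * (x : ℂ) + b.w)) + a.z) /
        (conj a.z * ((conj b.w * (x : ℂ) + b.z) / (conj b.z * (x : ℂ) + b.w)) + a.w)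
    have hb : conj b.z * (x : ℂ) + b.w ≠ 0 := by
      intro h0
      have h1 : ‖b.w‖ = ‖b.z‖ * ‖(x : ℂ)‖ := by
        rw [← Complex.norm_conj b.z, ← norm_mul, eq_neg_of_add_eq_zero_right h0, norm_neg]
      have h2 := b.norm_lt
      have h3 := x.norm_lt_one
      rw [b.norm_w] at h1
      nlinarith [norm_nonneg b.z, norm_nonneg (x : ℂ)]
    rw [← mul_div_mul_right _ (conj a.z * _ + a.w) hb]
    have e1 : (conj a.w * ((conj b.w * (x : ℂ) + b.z) / (conj b.z * (x : ℂ) + b.w)) + a.z) *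
        (conj b.z * (x : ℂ) + b.w) = conj (a * b).w * (x : ℂ) + (a * b).z := by
      rw [add_mul, mul_assoc, div_mul_cancel₀ _ hb, mul_w, mul_z]
      simp only [map_add, map_mul, Complex.conj_conj]; ring
    have e2 : (conj a.z * ((conj b.w * (x : ℂ) + b.z) / (conj b.z * (x : ℂ) + b.w)) + a.w) *
        (conj b.z * (x : ℂ) + b.w) = conj (a * b).z * (x : ℂ) + (a * b).w := by
      rw [add_mul, mul_assoc, div_mul_cancel₀ _ hb, mul_w, mul_z]
      simp only [map_add, map_mul, Complex.conj_conj]; ring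
    rw [e1, e2]

end LTilde

/-! ### The universal cover of `SU(1,1)` -/

/-- The universal cover of the quadric `G = SU(1,1)` inside `LTilde`: all `(z, α, r)` with
`|z|² = r² - 1`. -/
def unitSubgroup : Subgroup LTilde where
  carrier := {a | a.det = 1}
  mul_mem' {a b} ha hb := by
    change (a * b).det = 1
    rw [LTilde.det_mul, ha, hb, one_mul]
  one_mem' := LTilde.det_one
  inv_mem' {a} ha := by
    have h := LTilde.det_mul a⁻¹ a
    rw [inv_mul_cancel, LTilde.det_one, ha, mul_one] at h
    exact h.symm

/-- The universal cover `G̃` of `SU(1,1)`, with the group structure and topology inherited from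
`LTilde`. It acts on the unit disc by restriction of the action of `LTilde`. -/
abbrev GTilde : Type := ↥unitSubgroup

/-- The bundle map `θ : LTilde → G̃`, given by
`(z, α, r) ↦ (λ⁻¹ z, α, λ⁻¹ r)` with `λ = √(r² - |z|²)`. -/
def theta (a : LTilde) : GTilde :=
  ⟨{ z := a.z / (Real.sqrt a.det : ℂ)
     arg := a.arg
     r := a.r / Real.sqrt a.det
     norm_lt := by
      have h := Real.sqrt_pos.2 a.det_pos
      rw [norm_div, Complex.norm_real, Real.norm_eq_abs, abs_of_pos h]
      exact div_lt_div_of_pos_right a.norm_lt h }, by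
    have h := Real.sqrt_pos.2 a.det_pos
    change (a.r / Real.sqrt a.det) ^ 2 - ‖a.z / (Real.sqrt a.det : ℂ)‖ ^ 2 = 1
    rw [norm_div, Complex.norm_real, Real.norm_eq_abs, abs_of_pos h, div_pow, div_pow, ← sub_div,
      Real.sq_sqrt a.det_pos.le]
    exact div_self a.det_pos.ne'⟩

/-- `G̃ × G̃` acts on `LTilde` by `(g, h) · x = g x h⁻¹`. -/
instance : MulAction (GTilde × GTilde) LTilde where
  smul γ x := (γ.1 : LTilde) * x * (γ.2 : LTilde)⁻¹
  one_smul x := by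
    change ((1 : GTilde) : LTilde) * x * ((1 : GTilde) : LTilde)⁻¹ = x
    simp
  mul_smul γ δ x := by
    change ((γ.1 * δ.1 : GTilde) : LTilde) * x * ((γ.2 * δ.2 : GTilde) : LTilde)⁻¹ =
      (γ.1 : LTilde) * ((δ.1 : LTilde) * x * (δ.2 : LTilde)⁻¹) * (γ.2 : LTilde)⁻¹
    simp only [Subgroup.coe_mul]
    group

/-- `G̃ × G̃` acts on `G̃` by `(g, h) · x = g x h⁻¹`. -/
instance : MulAction (GTilde × GTilde) GTilde where
  smul γ x := γ.1 * x * γ.2⁻¹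
  one_smul x := by
    change (1 : GTilde) * x * (1 : GTilde)⁻¹ = x
    simp
  mul_smul γ δ x := by
    change γ.1 * δ.1 * x * (γ.2 * δ.2)⁻¹ = γ.1 * (δ.1 * x * δ.2⁻¹) * γ.2⁻¹
    group

/-- The centre `Z` of `G̃`; the quotient `G̃ ⧸ Z` is `PSU(1,1)`. -/
abbrev Z : Subgroup GTilde := Subgroup.center GTilde

/-- The isotropy group of `u` in the image of `Γ` in `PSU(1,1) = G̃ ⧸ Z`
(the centre acts trivially on the disc). -/
def isotropy (Γ : Subgroup GTilde) (u : 𝔻) : Subgroup (GTilde ⧸ Z) :=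
  (Γ ⊓ MulAction.stabilizer GTilde u).map (QuotientGroup.mk' Z)

/-- The order `p` of the isotropy group of `u` in the image of `Γ` in `PSU(1,1)`. -/
def isotropyOrder (Γ : Subgroup GTilde) (u : 𝔻) : ℕ := Nat.card (isotropy Γ u)

/-- The condition (*) on `Γ₁`, `Γ₂`, the fixed point `u` and the level `k`. -/
structure ConditionStar (Γ₁ Γ₂ : Subgroup GTilde) (u : 𝔻) (k : ℕ) : Prop where
  discrete₁ : DiscreteTopology Γ₁
  discrete₂ : DiscreteTopology Γ₂
  cyclic₂ : IsCyclic Γ₂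
  /-- the level is finite -/
  level_pos : 0 < k
  /-- `Γ₁ ∩ Z` has index `k` in `Z` -/
  level₁ : Γ₁.relIndex Z = k
  /-- `Γ₂ ∩ Z` has index `k` in `Z` -/
  level₂ : Γ₂.relIndex Z = k
  /-- `u` is fixed by a nontrivial element of the image of `Γ₁` in `PSU(1,1)` -/
  fixed₁ : ∃ g ∈ Γ₁, g ∉ Z ∧ g • u = u
  /-- `u` is fixed by a nontrivial element of the image of `Γ₂` in `PSU(1,1)` -/
  fixed₂ : ∃ g ∈ Γ₂, g ∉ Z ∧ g • u = u
  level_lt : k < Nat.lcm (isotropyOrder Γ₁ u) (isotropyOrder Γ₂ u)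

/-! ### Half-spaces, prisms and the polytope -/

/-- `I_g`: the connected component containing `g` of the preimage of the half-space
`⟨ḡ, a⟩ ≤ -1` of the cone `L`. -/
def I (g : GTilde) : Set LTilde :=
  connectedComponentIn {a : LTilde | form (g : LTilde).proj a.proj ≤ -1} g

/-- `H_g`: the closure of the complement of `I_g`. Since `I_g` is the closure of one of the
two components of the complement of the hypersurface `E_g = ∂I_g`, the complement of `I_g` is the
other component. -/
def H (g : GTilde) : Set LTilde := closure (I g)ᶜ

/-- The prism `Q_x`: the intersection of all `H_{g₁g₂}` with `g₁ ∈ Γ₁`, `g₂ ∈ Γ₂`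
and `g₁(u) = x`. -/
def Q (Γ₁ Γ₂ : Subgroup GTilde) (u x : 𝔻) : Set LTilde :=
  ⋂ g₁ ∈ Γ₁, ⋂ g₂ ∈ Γ₂, ⋂ (_ : g₁ • u = x), H (g₁ * g₂)

/-- The union `P` of the prisms `Q_x` over the orbit `Γ₁(u)`. -/
def P (Γ₁ Γ₂ : Subgroup GTilde) (u : 𝔻) : Set LTilde :=
  ⋃ x ∈ {x : 𝔻 | ∃ g ∈ Γ₁, g • u = x}, Q Γ₁ Γ₂ u x

/-- The boundary of `P` in `LTilde`. -/
def dP (Γ₁ Γ₂ : Subgroup GTilde) (u : 𝔻) : Set LTilde := frontier (P Γ₁ Γ₂ u)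

/-- The interior of `A ∩ X` relative to the subspace `X`. -/
def interiorIn {M : Type*} [TopologicalSpace M] (X A : Set M) : Set M :=
  Subtype.val '' interior (Subtype.val ⁻¹' A : Set X)

/-- The closure of `A ∩ X` relative to the subspace `X`. -/
def closureIn {M : Type*} [TopologicalSpace M] (X A : Set M) : Set M :=
  Subtype.val '' closure (Subtype.val ⁻¹' A : Set X)

/-- `F_g = Cl(Int(∂H_g ∩ ∂P))`, interior and closure taken in `∂P`. -/
def F (Γ₁ Γ₂ : Subgroup GTilde) (u : 𝔻) (g : GTilde) : Set LTilde :=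
  closureIn (dP Γ₁ Γ₂ u) (interiorIn (dP Γ₁ Γ₂ u) (frontier (H g) ∩ dP Γ₁ Γ₂ u))

/-- The image of `F_g` in `G̃`. -/
def calF (Γ₁ Γ₂ : Subgroup GTilde) (u : 𝔻) (g : GTilde) : Set GTilde :=
  theta '' F Γ₁ Γ₂ u g

/-- The set `Γ₁Γ₂` of all products `g₁g₂`. -/
def products (Γ₁ Γ₂ : Subgroup GTilde) : Set GTilde :=
  {g | ∃ g₁ ∈ Γ₁, ∃ g₂ ∈ Γ₂, g = g₁ * g₂}

/-! ### Fundamental domains -/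

/-- `D` is a fundamental domain modulo the subgroup `S` for the action of the group `Λ` on the
invariant subset `X` of the space `M`: it is closed in `X`, it is stable under
`Λ ∩ S`, the interior of `D` in `X` does not meet the translates of `D` by the elements of `Λ`
outside of `S`, the interiors of the translates have dense union in `X`, and the translates
cover `X`. If `S` consists of the elements that act trivially on `X`, then this is a fundamental
domain in the usual sense. -/
structure IsFundamentalDomainMod {A M : Type*} [Group A] [MulAction A M] [TopologicalSpace M]
    (Λ S : Subgroup A) (X D : Set M) : Prop where
  subset : D ⊆ X
  closed : closureIn X D = D
  stable : ∀ γ ∈ Λ, γ ∈ S → γ • D = D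
  disjoint : ∀ γ ∈ Λ, γ ∉ S → Disjoint (interiorIn X D) (γ • D)
  dense : closureIn X (⋃ γ ∈ Λ, interiorIn X (γ • D)) = X
  cover : ⋃ γ ∈ Λ, γ • D = X

/-! ### Totally geodesic surfaces -/

/-- The global chart `(z, α, r) ↦ (z, α)` of `G̃`. -/
def coord (g : GTilde) : ℂ × ℝ := ((g : LTilde).z, (g : LTilde).arg)

/-- Geodesics of the Lorentz metric that `G̃` inherits from `ℂ²` with the form of signature
`(2,2)`: smooth curves whose acceleration in `ℂ²` has vanishing tangential part, i.e. is
orthogonal to the tangent space `{v | ⟨ḡ, v⟩ = 0}` of the quadric. -/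
def IsGeodesic (c : ℝ → GTilde) : Prop :=
  ContDiff ℝ ∞ (fun t => coord (c t)) ∧
    ∀ t : ℝ, ∀ v : ℂ × ℂ, form (c t : LTilde).proj v = 0 →
      form (deriv (deriv fun s => (c s : LTilde).proj) t) v = 0

/-- `N` is a two-dimensional totally geodesic submanifold of `G̃`: near each of its points it is
the zero set of a smooth function without critical points in the chart `coord`, and each geodesic
that is tangent to `N` at a point stays in `N` for a short time. -/
def IsTotallyGeodesicSurface (N : Set GTilde) : Prop :=
  ∀ p ∈ N, ∃ (U : Set (ℂ × ℝ)) (f : ℂ × ℝ → ℝ),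
    IsOpen U ∧ coord p ∈ U ∧ ContDiffOn ℝ ∞ f U ∧ (∀ x ∈ U, fderiv ℝ f x ≠ 0) ∧
    (∀ q : GTilde, coord q ∈ U → (q ∈ N ↔ f (coord q) = 0)) ∧
    ∀ c : ℝ → GTilde, IsGeodesic c → c 0 = p →
      fderiv ℝ f (coord p) (deriv (fun t => coord (c t)) 0) = 0 → ∀ᶠ t in 𝓝 (0 : ℝ), c t ∈ N

end LorentzDomains

end

noncomputable section

namespace LorentzDomains

/-! ### The topological group `LTilde` -/

namespace LTilde

/-! Left translations by `G̃` are isometries, so `⟨g, a⟩ = -Re w(g⁻¹a)`, and `I_g`, `H_g` and `∂H_g`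
are given by `≥ 1`, `≤ 1` and `= 1` for the function `weight (g⁻¹ * a)`. Here `weight` is `Re w` on
the sheet `|α| < π/2` and zero elsewhere. It is continuous, homogeneous of degree one under scaling,
and invariant under conjugation by `G̃` because `Re w` is half a trace.

Let `u = t • 0`. Since `Γ₂` is abelian and contains a noncentral rotation about `u`, it consists of
rotations about `u`. The angles of rotations about `u` in `Γ₁` and `Γ₂` together generate a cyclic
group `φℤ`. It contains `kπ`, say `kπ = mφ`, and `lcm(p₁, p₂)` divides `m`, so `p > k` gives `φ < π`
(`ConditionStar.exists_isStep`). Hence `Q_u` is cut out by all rotations about `u` by multiples of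
`φ`. In coordinates centred at `u` the maximum of their weights is `r cos(dist(α, φℤ))`, which is
positive because `φ/2 < π/2`. This is `prismFn`, and the other prisms are its translates.

So `P` is the set where the infimum of the functions `prismFn (h⁻¹ * y)`, `h ∈ Γ₁Γ₂`, is at most
one. Over `G̃` the part of a prism's facet where `prismFn` is bounded is compact, and `Γ₁Γ₂` meets
compact sets in finite sets. The infimum is therefore a locally finite minimum: attained,
continuous, positive and invariant under `Γ₁ × Γ₂`. By homogeneity every ray meets `∂P` exactly
once, which makes `θ` a homeomorphism `∂P → G̃` and moves every statement to `G̃`.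

On `G̃` the set `∂H_g ∩ ∂P` becomes `touch g`, the set where `weight (g⁻¹ * a)` equals the minimum.
Two such sets with a common open subset belong to the same `g`: a linear form vanishing on an open
piece of the quadric is zero, and positivity of the weights fixes the sheet
(`eq_of_isOpen_subset_touch`). The explicit facets are closed, locally finite and cover `G̃`, so
their interiors are dense by Baire. Comparing them with `Cl(Int(touch g))` gives the fundamental
domains (`calF_subset_facet`, `interior_facet_subset`).

Points common to two domains satisfy `⟨g - h, a⟩ = 0`. Such a hyperplane section through the origin
is totally geodesic: a geodesic satisfies `γ'' = μγ`, so `⟨v, γ⟩` solves a linear homogeneous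
equation of second order. -/

theorem ext_of {a b : LTilde} (hz : a.z = b.z) (harg : a.arg = b.arg) (hr : a.r = b.r) :
    a = b := by
  cases a; cases b; simp_all

theorem isInducing_coords : Topology.IsInducing (fun a : LTilde => (a.z, a.arg, a.r)) := ⟨rfl⟩

theorem continuous_iff {X : Type*} [TopologicalSpace X] {f : X → LTilde} :
    Continuous f ↔ Continuous (fun x => (f x).z) ∧ Continuous (fun x => (f x).arg) ∧
      Continuous fun x => (f x).r := by
  rw [isInducing_coords.continuous_iff, continuous_prodMk, continuous_prodMk]
  rfl

@[fun_prop]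
theorem continuous_z : Continuous LTilde.z := (continuous_iff.1 continuous_id).1

@[fun_prop]
theorem continuous_arg : Continuous LTilde.arg := (continuous_iff.1 continuous_id).2.1

@[fun_prop]
theorem continuous_r : Continuous LTilde.r := (continuous_iff.1 continuous_id).2.2

@[fun_prop]
theorem continuous_w : Continuous LTilde.w := by
  unfold w; fun_prop

@[fun_prop]
theorem continuous_det : Continuous LTilde.det := by
  unfold det; fun_prop

instance : T2Space LTilde :=
  T2Space.of_injective_continuous (f := fun a : LTilde => (a.z, a.arg, a.r))
    (fun a b h => by
      simp only [Prod.mk.injEq] at h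
      exact ext_of h.1 h.2.1 h.2.2) isInducing_coords.continuous

theorem continuous_twist : Continuous fun x : LTilde × LTilde => twist x.1 x.2 := by
  unfold twist
  refine continuous_const.add (Continuous.div (by fun_prop) (by fun_prop) fun x => ?_)
  exact mul_ne_zero x.1.w_ne_zero x.2.w_ne_zero

/-- The values of `twist` have positive real part and so avoid the branch cut of `arg`. -/
theorem continuous_arg_twist : Continuous fun x : LTilde × LTilde => (twist x.1 x.2).arg := by
  rw [continuous_iff_continuousAt]
  intro x
  exact (Complex.continuousAt_arg (Or.inl (twist_re_pos x.1 x.2))).comp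
    (f := fun x : LTilde × LTilde => twist x.1 x.2) continuous_twist.continuousAt

instance : IsTopologicalGroup LTilde where
  continuous_mul := by
    refine continuous_iff.2 ⟨?_, ?_, ?_⟩
    · simp only [mul_z]; fun_prop
    · simp only [mul_arg]
      exact Continuous.add (by fun_prop) continuous_arg_twist
    · change Continuous fun x : LTilde × LTilde => ‖x.1.w * x.2.w + conj x.1.z * x.2.z‖
      fun_prop
  continuous_inv := by
    refine continuous_iff.2 ⟨?_, ?_, ?_⟩
    · simp only [inv_z]
      exact Continuous.div (by fun_prop) (by fun_prop)
        fun a => Complex.ofReal_ne_zero.2 a.det_pos.ne'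
    · simp only [inv_arg]; fun_prop
    · change Continuous fun a : LTilde => a.r / (a.r ^ 2 - ‖a.z‖ ^ 2)
      exact Continuous.div (by fun_prop) (by fun_prop) fun a => a.det_pos.ne'

theorem re_w (a : LTilde) : a.w.re = a.r * Real.cos a.arg := by
  rw [w, Complex.re_ofReal_mul, Complex.exp_ofReal_mul_I_re]

theorem mul_r (a b : LTilde) : (a * b).r = ‖a.w * b.w + conj a.z * b.z‖ := rfl

/-! ### Scaling -/

/-- Multiplication of the coordinates `z` and `r` by `eˢ`. -/
def scale (s : ℝ) (a : LTilde) : LTilde where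
  z := (Real.exp s : ℂ) * a.z
  arg := a.arg
  r := Real.exp s * a.r
  norm_lt := by
    rw [norm_mul, Complex.norm_real, Real.norm_eq_abs, abs_of_pos (Real.exp_pos s)]
    exact mul_lt_mul_of_pos_left a.norm_lt (Real.exp_pos s)

theorem scale_z (s : ℝ) (a : LTilde) : (scale s a).z = (Real.exp s : ℂ) * a.z := rfl

theorem scale_arg (s : ℝ) (a : LTilde) : (scale s a).arg = a.arg := rfl

theorem scale_r (s : ℝ) (a : LTilde) : (scale s a).r = Real.exp s * a.r := rfl

theorem scale_w (s : ℝ) (a : LTilde) : (scale s a).w = (Real.exp s : ℂ) * a.w := by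
  rw [w, w, scale_arg, scale_r]; push_cast; ring

theorem scale_zero (a : LTilde) : scale 0 a = a := by
  apply ext_of <;> simp [scale]

theorem scale_scale (s t : ℝ) (a : LTilde) : scale s (scale t a) = scale (s + t) a := by
  apply ext_of
  · simp only [scale_z, Real.exp_add]; push_cast; ring
  · rfl
  · simp only [scale_r, Real.exp_add]; ring

theorem continuous_scale : Continuous fun x : ℝ × LTilde => scale x.1 x.2 := by
  refine continuous_iff.2 ⟨?_, ?_, ?_⟩
  · simp only [scale_z]; fun_prop
  · simp only [scale_arg]; fun_prop
  · simp only [scale_r]; fun_prop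

theorem exp_ne_zero' (s : ℝ) : (Real.exp s : ℂ) ≠ 0 :=
  Complex.ofReal_ne_zero.2 (Real.exp_pos s).ne'

theorem twist_scale_left (s : ℝ) (a b : LTilde) : twist (scale s a) b = twist a b := by
  have := a.w_ne_zero
  have := b.w_ne_zero
  have := exp_ne_zero' s
  rw [twist, twist, scale_z, scale_w, map_mul, Complex.conj_ofReal]
  field_simp

theorem twist_scale_right (s : ℝ) (a b : LTilde) : twist a (scale s b) = twist a b := by
  have := a.w_ne_zero
  have := b.w_ne_zero
  have := exp_ne_zero' s
  rw [twist, twist, scale_z, scale_w]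
  field_simp

/-- Positive scalars commute with matrices, and the correction `twist` of the argument depends only
on the ratios `z / w`. -/
theorem scale_mul (s : ℝ) (a b : LTilde) : scale s a * b = scale s (a * b) := by
  apply ext_of
  · simp only [mul_z, scale_z, scale_w, map_mul, Complex.conj_ofReal]; ring
  · simp only [mul_arg, scale_arg, twist_scale_left]
  · have h : (Real.exp s : ℂ) * a.w * b.w + (Real.exp s : ℂ) * conj a.z * b.z =
      (Real.exp s : ℂ) * (a.w * b.w + conj a.z * b.z) := by ring
    simp only [mul_r, scale_r, scale_z, scale_w, map_mul, Complex.conj_ofReal]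
    rw [h, norm_mul, Complex.norm_real, Real.norm_eq_abs, abs_of_pos (Real.exp_pos s)]

theorem mul_scale (s : ℝ) (a b : LTilde) : a * scale s b = scale s (a * b) := by
  apply ext_of
  · simp only [mul_z, scale_z, scale_w]; ring
  · simp only [mul_arg, scale_arg, twist_scale_right]
  · have h : a.w * ((Real.exp s : ℂ) * b.w) + conj a.z * ((Real.exp s : ℂ) * b.z) =
      (Real.exp s : ℂ) * (a.w * b.w + conj a.z * b.z) := by ring
    simp only [mul_r, scale_r, scale_z, scale_w]
    rw [h, norm_mul, Complex.norm_real, Real.norm_eq_abs, abs_of_pos (Real.exp_pos s)]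

/-- The logarithm of the factor by which `a` differs from its projection to `G̃`. -/
def height (a : LTilde) : ℝ := Real.log (Real.sqrt a.det)

theorem exp_height (a : LTilde) : Real.exp a.height = Real.sqrt a.det :=
  Real.exp_log (Real.sqrt_pos.2 a.det_pos)

theorem continuous_height : Continuous height :=
  (continuous_det.sqrt).log fun a => (Real.sqrt_pos.2 a.det_pos).ne'

theorem coe_theta (a : LTilde) : (theta a : LTilde) = scale (-a.height) a := by
  have h : Real.exp (-a.height) = (Real.sqrt a.det)⁻¹ := by rw [Real.exp_neg, exp_height]
  apply ext_of
  · rw [scale_z, h]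
    change a.z / (Real.sqrt a.det : ℂ) = _
    push_cast
    rw [div_eq_inv_mul]
  · rfl
  · rw [scale_r, h]
    exact div_eq_inv_mul _ _

/-- With `height_scale` and `theta_scale` this gives polar coordinates: each point of the cone is a
unique multiple `eˢ` of a unique point of `G̃`. -/
theorem scale_theta (a : LTilde) : scale a.height (theta a : LTilde) = a := by
  rw [coe_theta, scale_scale, add_neg_cancel, scale_zero]

theorem continuous_theta : Continuous theta := by
  refine Topology.IsInducing.subtypeVal.continuous_iff.2 ?_
  have h : (fun a : LTilde => (theta a : LTilde)) = fun a => scale (-a.height) a :=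
    funext coe_theta
  change Continuous fun a : LTilde => (theta a : LTilde)
  rw [h]
  exact continuous_scale.comp (continuous_height.neg.prodMk continuous_id)

theorem det_scale (s : ℝ) (a : LTilde) : (scale s a).det = Real.exp s ^ 2 * a.det := by
  rw [det, det, scale_r, scale_z, norm_mul, Complex.norm_real, Real.norm_eq_abs,
    abs_of_pos (Real.exp_pos s)]
  ring

theorem height_scale (s : ℝ) (g : GTilde) : (scale s (g : LTilde)).height = s := by
  rw [height, det_scale, show (g : LTilde).det = 1 from g.2, mul_one,
    Real.sqrt_sq (Real.exp_pos s).le, Real.log_exp]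

theorem theta_scale (s : ℝ) (g : GTilde) : theta (scale s (g : LTilde)) = g := by
  apply Subtype.ext
  rw [coe_theta, height_scale, scale_scale, neg_add_cancel, scale_zero]

/-! ### The truncated linear function -/

/-- The function `Re w` on the region `|α| < π/2`, continued by zero. -/
def weight (a : LTilde) : ℝ := a.r * Real.cos (min |a.arg| (Real.pi / 2))

@[fun_prop]
theorem continuous_weight : Continuous weight := by
  unfold weight; fun_prop

theorem weight_scale (s : ℝ) (a : LTilde) : weight (scale s a) = Real.exp s * weight a := by
  rw [weight, weight, scale_r, scale_arg, mul_assoc]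

theorem weight_of_lt {a : LTilde} (h : |a.arg| < Real.pi / 2) : weight a = a.w.re := by
  rw [weight, min_eq_left h.le, Real.cos_abs, re_w]

theorem weight_of_le {a : LTilde} (h : Real.pi / 2 ≤ |a.arg|) : weight a = 0 := by
  rw [weight, min_eq_right h, Real.cos_pi_div_two, mul_zero]

theorem abs_arg_lt_of_weight_pos {a : LTilde} (h : 0 < weight a) : |a.arg| < Real.pi / 2 := by
  by_contra h'
  rw [weight_of_le (not_lt.1 h')] at h
  exact lt_irrefl _ h

theorem weight_pos_iff {a : LTilde} : 0 < weight a ↔ |a.arg| < Real.pi / 2 := by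
  refine ⟨abs_arg_lt_of_weight_pos, fun h => ?_⟩
  rw [weight_of_lt h, re_w]
  exact mul_pos a.r_pos (Real.cos_pos_of_mem_Ioo (abs_lt.1 h))

/-- To leave the interval `(-π/2, π/2)` a connected set of reals must contain one of its end points,
where the cosine vanishes. This is how sheets of the cover are told apart. -/
theorem abs_lt_of_isPreconnected {S : Set ℝ} (hS : IsPreconnected S)
    (hcos : ∀ x ∈ S, Real.cos x ≠ 0) {x y : ℝ} (hx : x ∈ S) (hy : y ∈ S)
    (h : |x| < Real.pi / 2) : |y| < Real.pi / 2 := by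
  rw [abs_lt] at h ⊢
  have hoc := hS.ordConnected
  constructor
  · by_contra h'
    exact hcos _ (hoc.out hy hx ⟨not_lt.1 h', h.1.le⟩) (by rw [Real.cos_neg, Real.cos_pi_div_two])
  · by_contra h'
    exact hcos _ (hoc.out hx hy ⟨h.2.le, not_lt.1 h'⟩) Real.cos_pi_div_two

end LTilde

/-! ### The group `G̃` -/

open LTilde

theorem det_coe (g : GTilde) : (g : LTilde).det = 1 := g.2

theorem r_sq (g : GTilde) : (g : LTilde).r ^ 2 = 1 + ‖(g : LTilde).z‖ ^ 2 := by
  have := det_coe g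
  rw [det] at this
  linarith

theorem r_eq (g : GTilde) : (g : LTilde).r = Real.sqrt (1 + ‖(g : LTilde).z‖ ^ 2) := by
  rw [← r_sq, Real.sqrt_sq (r_pos _).le]

/-- The inverse of the chart `coord`. -/
def ofCoord (x : ℂ × ℝ) : GTilde :=
  ⟨{ z := x.1
     arg := x.2
     r := Real.sqrt (1 + ‖x.1‖ ^ 2)
     norm_lt := Real.lt_sqrt_of_sq_lt (by linarith) }, by
    change Real.sqrt (1 + ‖x.1‖ ^ 2) ^ 2 - ‖x.1‖ ^ 2 = 1
    rw [Real.sq_sqrt (by positivity)]; ring⟩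

theorem coord_ofCoord (x : ℂ × ℝ) : coord (ofCoord x) = x := rfl

theorem ofCoord_coord (g : GTilde) : ofCoord (coord g) = g := by
  apply Subtype.ext
  exact ext_of rfl rfl (r_eq g).symm

theorem continuous_coord : Continuous coord := by
  unfold coord; fun_prop

theorem continuous_ofCoord : Continuous ofCoord := by
  refine Topology.IsInducing.subtypeVal.continuous_iff.2 (LTilde.continuous_iff.2 ⟨?_, ?_, ?_⟩)
  · exact continuous_fst
  · exact continuous_snd
  · change Continuous fun x : ℂ × ℝ => Real.sqrt (1 + ‖x.1‖ ^ 2)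
    fun_prop

/-- The chart `coord` as a homeomorphism. -/
def coordHomeomorph : GTilde ≃ₜ ℂ × ℝ where
  toFun := coord
  invFun := ofCoord
  left_inv := ofCoord_coord
  right_inv := coord_ofCoord
  continuous_toFun := continuous_coord
  continuous_invFun := continuous_ofCoord

instance : LocallyCompactSpace GTilde := coordHomeomorph.isOpenEmbedding.locallyCompactSpace

instance : SecondCountableTopology GTilde := coordHomeomorph.secondCountableTopology

instance : ConnectedSpace GTilde :=
  coordHomeomorph.symm.surjective.connectedSpace coordHomeomorph.symm.continuous

/-- The lift of the rotations of the disc about the origin. -/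
def rot (s : ℝ) : GTilde :=
  ⟨⟨0, s, 1, by simp⟩, by change (1 : ℝ) ^ 2 - ‖(0 : ℂ)‖ ^ 2 = 1; simp⟩

theorem rot_z (s : ℝ) : (rot s : LTilde).z = 0 := rfl

theorem rot_arg (s : ℝ) : (rot s : LTilde).arg = s := rfl

theorem rot_r (s : ℝ) : (rot s : LTilde).r = 1 := rfl

theorem rot_w (s : ℝ) : (rot s : LTilde).w = Complex.exp (s * Complex.I) := by
  rw [w, rot_arg, rot_r]; simp

theorem rot_mul_arg (s : ℝ) (a : LTilde) : ((rot s : LTilde) * a).arg = s + a.arg := by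
  rw [mul_arg, rot_arg, twist, rot_z]; simp

theorem rot_mul_r (s : ℝ) (a : LTilde) : ((rot s : LTilde) * a).r = a.r := by
  rw [mul_r, rot_z, rot_w, map_zero, zero_mul, add_zero, norm_mul, Complex.norm_exp_ofReal_mul_I,
    one_mul, norm_w]

theorem rot_add (s t : ℝ) : rot (s + t) = rot s * rot t := by
  apply Subtype.ext
  rw [Subgroup.coe_mul]
  refine ext_of ?_ ?_ ?_
  · rw [mul_z, rot_z, rot_z, rot_z]; simp
  · rw [rot_mul_arg]; rfl
  · rw [rot_mul_r]; rfl

theorem rot_zero : rot 0 = 1 := Subtype.ext rfl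

theorem eq_rot_of_z_eq_zero {g : GTilde} (h : (g : LTilde).z = 0) : g = rot (g : LTilde).arg := by
  apply Subtype.ext
  refine ext_of h rfl ?_
  rw [r_eq, h, rot_r]; simp

theorem rot_neg (s : ℝ) : rot (-s) = (rot s)⁻¹ := by
  rw [eq_inv_iff_mul_eq_one, ← rot_add, neg_add_cancel, rot_zero]

theorem coe_inv_z (g : GTilde) : (g : LTilde)⁻¹.z = -(g : LTilde).z := by
  have h : (g : LTilde).r ^ 2 - ‖(g : LTilde).z‖ ^ 2 = 1 := g.2
  rw [inv_z, h]; simp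

theorem coe_inv_w (g : GTilde) : (g : LTilde)⁻¹.w = conj (g : LTilde).w := by
  have h : (g : LTilde).r ^ 2 - ‖(g : LTilde).z‖ ^ 2 = 1 := g.2
  rw [inv_w, h]; simp

/-! ### Invariance of the form and of the truncated linear function -/

/-- Left translation by `g⁻¹` is an isometry, and the form with the unit is `-Re w`. -/
theorem form_coe_eq (g : GTilde) (a : LTilde) :
    form (g : LTilde).proj a.proj = -(((g : LTilde)⁻¹ * a).w).re := by
  rw [mul_w, coe_inv_z, coe_inv_w]
  simp only [form, proj, Complex.sub_re, Complex.add_re, Complex.mul_re, Complex.conj_re,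
    Complex.conj_im, map_neg, Complex.neg_re, Complex.neg_im]
  ring

/-- The number `2 Re w` is the trace of the matrix. -/
theorem re_w_conj (h : GTilde) (a : LTilde) :
    ((h : LTilde) * a * (h : LTilde)⁻¹).w.re = a.w.re := by
  have hd : Complex.normSq (h : LTilde).w - Complex.normSq (h : LTilde).z = 1 := by
    rw [← det_eq]; exact h.2
  rw [mul_w, mul_w, mul_z, coe_inv_z, coe_inv_w]
  rw [Complex.normSq_apply, Complex.normSq_apply] at hd
  simp only [map_add, map_mul, Complex.conj_conj, Complex.add_re, Complex.add_im, Complex.mul_re,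
    Complex.mul_im, Complex.conj_re, Complex.conj_im, Complex.neg_re, Complex.neg_im]
  linear_combination a.w.re * hd

/-- As the conjugating element varies in the connected group `G̃`, the positive number `Re w` is
constant, so the argument cannot reach `±π/2`. -/
theorem abs_arg_conj_lt (h : GTilde) {a : LTilde} (ha : |a.arg| < Real.pi / 2) :
    |((h : LTilde) * a * (h : LTilde)⁻¹).arg| < Real.pi / 2 := by
  have hc : Continuous fun g : GTilde => ((g : LTilde) * a * (g : LTilde)⁻¹).arg := by
    have h0 : Continuous fun g : GTilde => (g : LTilde) * a * (g : LTilde)⁻¹ :=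
      (continuous_subtype_val.mul continuous_const).mul continuous_subtype_val.inv
    exact Continuous.comp (g := LTilde.arg) LTilde.continuous_arg h0
  refine abs_lt_of_isPreconnected (isPreconnected_range hc) ?_ ⟨1, rfl⟩ ⟨h, rfl⟩ (by simpa using ha)
  rintro _ ⟨g, rfl⟩ h0
  have h1 := re_w_conj g a
  rw [re_w, h0, mul_zero, re_w] at h1
  exact (mul_pos a.r_pos (Real.cos_pos_of_mem_Ioo (abs_lt.1 ha))).ne h1

theorem weight_conj (h : GTilde) (a : LTilde) :
    weight ((h : LTilde) * a * (h : LTilde)⁻¹) = weight a := by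
  by_cases ha : |a.arg| < Real.pi / 2
  · rw [weight_of_lt ha, weight_of_lt (abs_arg_conj_lt h ha), re_w_conj]
  · rw [weight_of_le (not_lt.1 ha), weight_of_le]
    by_contra h'
    refine ha ?_
    have := abs_arg_conj_lt h⁻¹ (not_le.1 h')
    simpa [mul_assoc] using this

/-! ### Half-spaces -/

/-- Each point is joined to the unit by two segments in the coordinates: contract `z` and `α` to
zero with `r` fixed, which only increases `cos α`, then decrease `r` to one. -/
theorem isPreconnected_one_le_weight : IsPreconnected {a : LTilde | 1 ≤ weight a} := by
  rw [← isInducing_coords.isPreconnected_image]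
  have hmem : ∀ z : ℂ, ∀ α r : ℝ, ‖z‖ < r → |α| < Real.pi / 2 → 1 ≤ r * Real.cos α →
      (z, α, r) ∈ (fun a : LTilde => (a.z, a.arg, a.r)) '' {a : LTilde | 1 ≤ weight a} := by
    intro z α r hz hα hr
    refine ⟨⟨z, α, r, hz⟩, ?_, rfl⟩
    change 1 ≤ weight ⟨z, α, r, hz⟩
    rw [weight_of_lt (by exact hα), re_w]
    exact hr
  refine isPreconnected_of_forall ((0 : ℂ), (0 : ℝ), (1 : ℝ)) ?_
  rintro _ ⟨a, ha, rfl⟩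
  have ha' : 1 ≤ weight a := ha
  have harg := weight_pos_iff.1 (one_pos.trans_le ha')
  rw [weight_of_lt harg, re_w] at ha'
  have hr : 1 ≤ a.r := ha'.trans (mul_le_of_le_one_right a.r_pos.le (Real.cos_le_one _))
  refine ⟨segment ℝ ((0 : ℂ), (0 : ℝ), a.r) (a.z, a.arg, a.r) ∪
    segment ℝ ((0 : ℂ), (0 : ℝ), a.r) ((0 : ℂ), (0 : ℝ), (1 : ℝ)), ?_,
    Or.inr (right_mem_segment ℝ _ _), Or.inl (right_mem_segment ℝ _ _),
    IsPreconnected.union _ (left_mem_segment ℝ _ _) (left_mem_segment ℝ _ _)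
      (convex_segment _ _).isPreconnected (convex_segment _ _).isPreconnected⟩
  rintro _ (⟨p, q, hp, hq, hpq, rfl⟩ | ⟨p, q, hp, hq, hpq, rfl⟩)
  · have e : p • ((0 : ℂ), (0 : ℝ), a.r) + q • (a.z, a.arg, a.r) = (q * a.z, q * a.arg, a.r) := by
      simp only [Prod.smul_mk, Prod.mk_add_mk, smul_zero, mul_zero, zero_add,
        ← add_mul, hpq, one_mul, smul_eq_mul, Complex.real_smul]
    rw [e]
    have hq1 : q ≤ 1 := by linarith
    have habs : |q * a.arg| ≤ |a.arg| := by
      rw [abs_mul, abs_of_nonneg hq]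
      exact mul_le_of_le_one_left (abs_nonneg _) hq1
    refine hmem _ _ _ ?_ (habs.trans_lt harg) (ha'.trans ?_)
    · rw [norm_mul, Complex.norm_real, Real.norm_eq_abs, abs_of_nonneg hq]
      exact (mul_le_of_le_one_left (norm_nonneg _) hq1).trans_lt a.norm_lt
    · refine mul_le_mul_of_nonneg_left ?_ a.r_pos.le
      rw [← Real.cos_abs a.arg, ← Real.cos_abs (q * a.arg)]
      exact Real.cos_le_cos_of_nonneg_of_le_pi (abs_nonneg _)
        (by linarith [Real.pi_pos]) habs
  · have e : p • ((0 : ℂ), (0 : ℝ), a.r) + q • ((0 : ℂ), (0 : ℝ), (1 : ℝ)) =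
        (0, 0, p * a.r + q) := by
      simp
    rw [e]
    have h1 : 1 ≤ p * a.r + q := by nlinarith
    exact hmem _ _ _ (by rw [norm_zero]; linarith) (by rw [abs_zero]; positivity) (by simpa using h1)

/-- On the component of `g` one has `Re w(g⁻¹b) ≥ 1`, so the argument of `g⁻¹b`, which is zero at
`g`, stays inside `(-π/2, π/2)`. Conversely the set on the right is a translate of a connected set
and contains `g`. -/
theorem I_eq (g : GTilde) : I g = {a : LTilde | 1 ≤ weight ((g : LTilde)⁻¹ * a)} := by
  have hg : (g : LTilde) ∈ {a : LTilde | 1 ≤ weight ((g : LTilde)⁻¹ * a)} := by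
    change 1 ≤ weight ((g : LTilde)⁻¹ * g)
    rw [inv_mul_cancel, weight_of_lt, one_w, Complex.one_re]
    rw [one_arg, abs_zero]; positivity
  have hsub : {a : LTilde | 1 ≤ weight ((g : LTilde)⁻¹ * a)} ⊆
      {a : LTilde | form (g : LTilde).proj a.proj ≤ -1} := by
    intro a ha
    have ha' : 1 ≤ weight ((g : LTilde)⁻¹ * a) := ha
    change form (g : LTilde).proj a.proj ≤ -1
    rw [weight_of_lt (weight_pos_iff.1 (one_pos.trans_le ha'))] at ha'
    rw [form_coe_eq]
    linarith
  apply Set.Subset.antisymm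
  · intro a ha
    have hpre : IsPreconnected (I g) := isPreconnected_connectedComponentIn
    have hc : Continuous fun a : LTilde => ((g : LTilde)⁻¹ * a).arg :=
      Continuous.comp (g := LTilde.arg) LTilde.continuous_arg (continuous_const_mul _)
    have hle : ∀ b ∈ I g, 1 ≤ ((g : LTilde)⁻¹ * b).w.re := by
      intro b hb
      have : b ∈ {a : LTilde | form (g : LTilde).proj a.proj ≤ -1} :=
        connectedComponentIn_subset _ _ hb
      rw [Set.mem_ofPred_eq] at this
      rw [form_coe_eq] at this
      linarith
    have harg : |((g : LTilde)⁻¹ * a).arg| < Real.pi / 2 := by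
      refine abs_lt_of_isPreconnected (hpre.image _ hc.continuousOn) ?_
        ⟨_, mem_connectedComponentIn (hsub hg), rfl⟩ ⟨a, ha, rfl⟩ ?_
      · rintro _ ⟨b, hb, rfl⟩ h0
        have := hle b hb
        rw [re_w, h0, mul_zero] at this
        linarith
      · change |((g : LTilde)⁻¹ * g).arg| < _
        rw [inv_mul_cancel, one_arg, abs_zero]; positivity
    change 1 ≤ weight _
    rw [weight_of_lt harg]
    exact hle a ha
  · refine IsPreconnected.subset_connectedComponentIn ?_ hg hsub
    have h := isPreconnected_one_le_weight.image (fun a : LTilde => (g : LTilde) * a)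
      (continuous_const_mul _).continuousOn
    convert h using 1
    ext a
    constructor
    · intro ha
      exact ⟨(g : LTilde)⁻¹ * a, ha, by simp⟩
    · rintro ⟨b, hb, rfl⟩
      change 1 ≤ weight ((g : LTilde)⁻¹ * (g * b))
      rwa [inv_mul_cancel_left]

/-! ### Sublevel sets of functions that are homogeneous of degree one along rays -/

section Homogeneous

variable {N : LTilde → ℝ}

theorem exists_scale_mem {U : Set LTilde} (hU : IsOpen U) {a : LTilde} (ha : a ∈ U) :
    ∃ s > 0, scale s a ∈ U ∧ scale (-s) a ∈ U := by
  have h1 : Continuous fun s : ℝ => scale s a :=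
    continuous_scale.comp (f := fun s : ℝ => (s, a)) (by fun_prop)
  have h2 : Continuous fun s : ℝ => scale (-s) a := h1.comp continuous_neg
  have e1 : ∀ᶠ s in 𝓝 (0 : ℝ), scale s a ∈ U :=
    h1.continuousAt.eventually_mem (hU.mem_nhds (by rwa [scale_zero]))
  have e2 : ∀ᶠ s in 𝓝 (0 : ℝ), scale (-s) a ∈ U :=
    h2.continuousAt.eventually_mem (hU.mem_nhds (by rwa [neg_zero, scale_zero]))
  obtain ⟨s, ⟨hs1, hs2⟩, hs⟩ :=
    (((e1.and e2).filter_mono nhdsWithin_le_nhds).and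
      (self_mem_nhdsWithin : Set.Ioi (0 : ℝ) ∈ 𝓝[>] (0 : ℝ))).exists
  exact ⟨s, hs, hs1, hs2⟩

/-- Shrinking a point slightly along its ray makes a positive value strictly smaller; a value that
is not positive stays below one. -/
theorem closure_lt_one (hN : Continuous N) (hs : ∀ s a, N (scale s a) = Real.exp s * N a) :
    closure {a | N a < 1} = {a | N a ≤ 1} := by
  apply Set.Subset.antisymm
  · exact closure_minimal (fun a (ha : N a < 1) => ha.le) (isClosed_le hN continuous_const)
  · intro a ha
    have ha' : N a ≤ 1 := ha
    rw [mem_closure_iff]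
    intro U hU haU
    obtain ⟨s, hs0, -, hs1⟩ := exists_scale_mem hU haU
    refine ⟨_, hs1, ?_⟩
    change N _ < 1
    rw [hs]
    have h1 : Real.exp (-s) < 1 := Real.exp_lt_one_iff.2 (by linarith)
    have h2 := Real.exp_pos (-s)
    rcases le_or_gt (N a) 0 with h | h <;> nlinarith

/-- At a point of value one, going outwards along the ray leaves the sublevel set at once. -/
theorem frontier_le_one (hN : Continuous N) (hs : ∀ s a, N (scale s a) = Real.exp s * N a) :
    frontier {a | N a ≤ 1} = {a | N a = 1} := by
  apply Set.Subset.antisymm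
  · exact frontier_le_subset_eq hN continuous_const
  · intro a ha
    have ha' : N a = 1 := ha
    rw [frontier, (isClosed_le hN continuous_const).closure_eq]
    refine ⟨ha'.le, fun hint => ?_⟩
    obtain ⟨s, hs0, hs1, -⟩ := exists_scale_mem isOpen_interior hint
    have h1 : scale s a ∈ {a | N a ≤ 1} := interior_subset hs1
    rw [Set.mem_ofPred_eq] at h1
    rw [hs, ha', mul_one] at h1
    exact absurd h1 (not_le.2 (Real.one_lt_exp_iff.2 hs0))

end Homogeneous

theorem weight_inv_mul_scale (g : LTilde) (s : ℝ) (a : LTilde) :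
    weight (g⁻¹ * scale s a) = Real.exp s * weight (g⁻¹ * a) := by
  rw [mul_scale, weight_scale]

theorem continuous_weight_inv_mul (g : LTilde) : Continuous fun a => weight (g⁻¹ * a) :=
  Continuous.comp (g := weight) continuous_weight (continuous_const_mul _)

theorem H_eq (g : GTilde) : H g = {a : LTilde | weight ((g : LTilde)⁻¹ * a) ≤ 1} := by
  rw [H, I_eq, ← closure_lt_one (continuous_weight_inv_mul g) (weight_inv_mul_scale g)]
  congr 1
  ext a
  simp

theorem frontier_H (g : GTilde) :
    frontier (H g) = {a : LTilde | weight ((g : LTilde)⁻¹ * a) = 1} := by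
  rw [H_eq, frontier_le_one (continuous_weight_inv_mul g) (weight_inv_mul_scale g)]

/-! ### The centre and the stabilizers of points of the disc -/

theorem coe_smul_disc (g : GTilde) (x : 𝔻) : ((g • x : 𝔻) : ℂ) =
    (conj (g : LTilde).w * (x : ℂ) + (g : LTilde).z) /
      (conj (g : LTilde).z * (x : ℂ) + (g : LTilde).w) := rfl

theorem smul_zero_eq_zero_iff (g : GTilde) : g • (0 : 𝔻) = 0 ↔ (g : LTilde).z = 0 := by
  rw [← Complex.UnitDisc.coe_eq_zero, coe_smul_disc]
  simp [(g : LTilde).w_ne_zero]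

theorem exists_smul_zero_eq (u : 𝔻) : ∃ t : GTilde, t • (0 : 𝔻) = u := by
  -- An element sends `0` to `z / w`, and normalizing by `theta` keeps this ratio.
  let a : LTilde := ⟨u, 0, 1, u.norm_lt_one⟩
  refine ⟨theta a, Complex.UnitDisc.coe_injective ?_⟩
  have hw : a.w = 1 := by simp [w, a]
  rw [coe_smul_disc, coe_theta, scale_z, scale_w, hw, Complex.UnitDisc.coe_zero]
  have := exp_ne_zero' (-a.height)
  simp only [mul_zero, zero_add, mul_one]
  rw [mul_div_cancel_left₀ _ this]

theorem rot_int_mul_pi_w (n : ℤ) : (rot (n * Real.pi) : LTilde).w = Real.cos (n * Real.pi) := by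
  apply Complex.ext
  · rw [re_w, rot_r, rot_arg, one_mul, Complex.ofReal_re]
  · rw [rot_w, Complex.exp_ofReal_mul_I_im, Real.sin_int_mul_pi, Complex.ofReal_im]

/-- Below, this element is a real scalar matrix. The arguments of the two products differ by less
than `π`, so the equality lifts. -/
theorem rot_int_mul_pi_mul (n : ℤ) (a : LTilde) :
    (rot (n * Real.pi) : LTilde) * a = a * rot (n * Real.pi) := by
  apply eq_of
  · rw [mul_z, mul_z, rot_z, rot_int_mul_pi_w, Complex.conj_ofReal]; ring
  · rw [mul_w, mul_w, rot_z, rot_int_mul_pi_w, map_zero]; ring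
  · rw [mul_arg, mul_arg]
    have h1 := abs_lt.1 (abs_arg_twist (rot (n * Real.pi)) a)
    have h2 := abs_lt.1 (abs_arg_twist a (rot (n * Real.pi)))
    rw [abs_lt]
    constructor <;> linarith

theorem mem_Z_iff {g : GTilde} : g ∈ Z ↔ ∃ n : ℤ, g = rot (n * Real.pi) := by
  rw [Subgroup.mem_center_iff]
  constructor
  · intro h
    have hz : (g : LTilde).z = 0 := by
      -- Commuting with the rotation for which `w = i` gives `-iz = iz`, hence `z = 0`.
      have h1 := congrArg (fun x : GTilde => (x : LTilde).z) (h (rot (Real.pi / 2)))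
      simp only [Subgroup.coe_mul] at h1
      rw [mul_z, mul_z, rot_z, rot_w, Complex.ofReal_div, Complex.ofReal_ofNat,
        Complex.exp_pi_div_two_mul_I, Complex.conj_I, mul_zero, zero_mul, zero_add, add_zero] at h1
      have h2 : (2 * Complex.I) * (g : LTilde).z = 0 := by linear_combination -h1
      exact (mul_eq_zero.1 h2).resolve_left (mul_ne_zero two_ne_zero Complex.I_ne_zero)
    have hg := eq_rot_of_z_eq_zero hz
    -- Commuting with an element for which `z = 1` makes `w` real, so the argument is a multiple of
    -- `π`.
    have h1 := congrArg (fun x : GTilde => (x : LTilde).z) (h (ofCoord (1, 0)))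
    simp only [Subgroup.coe_mul] at h1
    have h3 : (ofCoord (1, 0) : LTilde).z = 1 := rfl
    rw [mul_z, mul_z, hz, h3, mul_zero, zero_mul, zero_add, add_zero, mul_one, one_mul] at h1
    have h2 := congrArg Complex.im h1
    rw [Complex.conj_im, hg, rot_w, Complex.exp_ofReal_mul_I_im] at h2
    obtain ⟨n, hn⟩ := Real.sin_eq_zero_iff.1 (show Real.sin (g : LTilde).arg = 0 by linarith)
    exact ⟨n, by rw [hn]; exact hg⟩
  · rintro ⟨n, rfl⟩ g
    apply Subtype.ext
    rw [Subgroup.coe_mul, Subgroup.coe_mul, rot_int_mul_pi_mul]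

/-- The group of rotations of the disc about the point `t • 0`, parametrized by the line. -/
def rotHom (t : GTilde) : Multiplicative ℝ →* GTilde where
  toFun s := t * rot s.toAdd * t⁻¹
  map_one' := by rw [toAdd_one, rot_zero]; group
  map_mul' a b := by rw [toAdd_mul, rot_add]; group

/-- The rotation by `s` about the point `t • 0`. -/
def rotAt (t : GTilde) (s : ℝ) : GTilde := t * rot s * t⁻¹

theorem rotAt_add (t : GTilde) (s s' : ℝ) : rotAt t (s + s') = rotAt t s * rotAt t s' :=
  (rotHom t).map_mul (Multiplicative.ofAdd s) (Multiplicative.ofAdd s')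

theorem rotAt_zero (t : GTilde) : rotAt t 0 = 1 := (rotHom t).map_one

theorem rotAt_natCast_mul (t : GTilde) (n : ℕ) (s : ℝ) : rotAt t (n * s) = rotAt t s ^ n := by
  rw [← nsmul_eq_mul]
  exact (rotHom t).map_pow (Multiplicative.ofAdd s) n

theorem rotAt_intCast_mul (t : GTilde) (n : ℤ) (s : ℝ) : rotAt t (n * s) = rotAt t s ^ n := by
  rw [← zsmul_eq_mul]
  exact (rotHom t).map_zpow (Multiplicative.ofAdd s) n

theorem rotAt_mem_Z_iff {t : GTilde} {s : ℝ} : rotAt t s ∈ Z ↔ ∃ n : ℤ, s = n * Real.pi := by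
  have h : rotAt t s ∈ Z ↔ rot s ∈ Z := by
    refine ⟨fun h => ?_, fun h => (inferInstance : Z.Normal).conj_mem _ h t⟩
    have := (inferInstance : Z.Normal).conj_mem _ h t⁻¹
    rwa [rotAt, inv_inv, show t⁻¹ * (t * rot s * t⁻¹) * t = rot s by group] at this
  rw [h, mem_Z_iff]
  refine exists_congr fun n => ⟨fun hn => ?_, fun hn => by rw [hn]⟩
  exact congrArg (fun g : GTilde => (g : LTilde).arg) hn

theorem smul_eq_iff {t : GTilde} {u : 𝔻} (ht : t • (0 : 𝔻) = u) {g : GTilde} :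
    g • u = u ↔ ∃ s, g = rotAt t s := by
  have h : g • u = u ↔ (t⁻¹ * g * t) • (0 : 𝔻) = 0 := by
    rw [mul_smul, mul_smul, ht, inv_smul_eq_iff, ht]
  rw [h, smul_zero_eq_zero_iff]
  constructor
  · intro hz
    refine ⟨((t⁻¹ * g * t : GTilde) : LTilde).arg, ?_⟩
    rw [rotAt, ← eq_rot_of_z_eq_zero hz]; group
  · rintro ⟨s, rfl⟩
    rw [rotAt, show t⁻¹ * (t * rot s * t⁻¹) * t = rot s by group, rot_z]

theorem rotAt_smul {t : GTilde} {u : 𝔻} (ht : t • (0 : 𝔻) = u) (s : ℝ) : rotAt t s • u = u :=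
  (smul_eq_iff ht).2 ⟨s, rfl⟩

theorem eq_zero_of_rot_smul {s : ℝ} {x : 𝔻} (h : rot s • x = x)
    (hs : ¬∃ n : ℤ, s = n * Real.pi) : x = 0 := by
  have h1 := congrArg (fun x : 𝔻 => (x : ℂ)) h
  simp only [coe_smul_disc, rot_z, rot_w, map_zero, zero_mul, zero_add, add_zero] at h1
  rw [div_eq_iff (Complex.exp_ne_zero _)] at h1
  by_contra hx
  have hx' : (x : ℂ) ≠ 0 := fun h => hx (Complex.UnitDisc.coe_eq_zero.1 h)
  have h2 := mul_left_cancel₀ hx' ((mul_comm (x : ℂ) _).trans h1)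
  have h3 := congrArg Complex.im h2
  rw [Complex.conj_im, Complex.exp_ofReal_mul_I_im] at h3
  obtain ⟨n, hn⟩ := Real.sin_eq_zero_iff.1 (show Real.sin s = 0 by linarith)
  exact hs ⟨n, hn.symm⟩

theorem eq_of_rotAt_smul {t : GTilde} {u x : 𝔻} (ht : t • (0 : 𝔻) = u) {s : ℝ}
    (h : rotAt t s • x = x) (hs : rotAt t s ∉ Z) : x = u := by
  rw [rotAt_mem_Z_iff] at hs
  have h1 : rot s • (t⁻¹ • x) = t⁻¹ • x := by
    rw [rotAt, mul_smul, mul_smul] at h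
    exact eq_inv_smul_iff.2 h
  rw [← ht, ← eq_zero_of_rot_smul h1 hs, smul_inv_smul]

/-- A cyclic group is abelian, so each element commutes with a noncentral rotation about `u` and
must preserve its only fixed point. -/
theorem smul_eq_of_isCyclic {Γ : Subgroup GTilde} (hΓ : IsCyclic Γ) {u : 𝔻}
    (hfix : ∃ g ∈ Γ, g ∉ Z ∧ g • u = u) {h : GTilde} (hh : h ∈ Γ) : h • u = u := by
  obtain ⟨t, ht⟩ := exists_smul_zero_eq u
  obtain ⟨g, hg, hgZ, hgu⟩ := hfix
  have hcomm : g * h = h * g := by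
    have := hΓ.isMulCommutative.is_comm.comm (⟨g, hg⟩ : Γ) ⟨h, hh⟩
    exact congrArg Subtype.val this
  obtain ⟨s, rfl⟩ := (smul_eq_iff ht).1 hgu
  refine eq_of_rotAt_smul ht ?_ hgZ
  rw [smul_smul, hcomm, mul_smul, hgu]

/-! ### Angles of rotation -/

/-- The angles of the rotations about `t • 0` in the group `Γ`. -/
def angles (t : GTilde) (Γ : Subgroup GTilde) : AddSubgroup ℝ :=
  Subgroup.toAddSubgroup' (Γ.comap (rotHom t))

theorem mem_angles {t : GTilde} {Γ : Subgroup GTilde} {s : ℝ} :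
    s ∈ angles t Γ ↔ rotAt t s ∈ Γ := Iff.rfl

/-- Rotation by `π` is central, and the power with exponent the index of `Γ ∩ Z` in `Z` brings it
into `Γ`. -/
theorem level_mul_pi_mem_angles {Γ : Subgroup GTilde} {k : ℕ} (h : Γ.relIndex Z = k) (t : GTilde) :
    k * Real.pi ∈ angles t Γ := by
  have h1 : rotAt t Real.pi ∈ Z := rotAt_mem_Z_iff.2 ⟨1, by simp⟩
  have h2 := Subgroup.pow_index_mem (Γ.subgroupOf Z) ⟨_, h1⟩
  rw [mem_angles, rotAt_natCast_mul, ← h]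
  exact h2

theorem mk_rotAt_mem_isotropy {Γ : Subgroup GTilde} {t : GTilde} {u : 𝔻} (ht : t • (0 : 𝔻) = u)
    {s : ℝ} (hs : s ∈ angles t Γ) : QuotientGroup.mk' Z (rotAt t s) ∈ isotropy Γ u :=
  Subgroup.mem_map_of_mem _ ⟨hs, rotAt_smul ht s⟩

/-- A group is annihilated by its order. If the isotropy group is infinite, its order counts as zero
and the assertion is trivial. -/
theorem isotropyOrder_mul_mem {Γ : Subgroup GTilde} {t : GTilde} {u : 𝔻} (ht : t • (0 : 𝔻) = u)
    {s : ℝ} (hs : s ∈ angles t Γ) : ∃ n : ℤ, isotropyOrder Γ u * s = n * Real.pi := by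
  rw [← rotAt_mem_Z_iff (t := t), rotAt_natCast_mul, ← QuotientGroup.eq_one_iff]
  have := pow_card_eq_one' (x := (⟨_, mk_rotAt_mem_isotropy ht hs⟩ : isotropy Γ u))
  exact congrArg Subtype.val this

/-- Such a group lies in the multiples of `π / N`, so zero is isolated in it and it is cyclic; the
element `kπ` makes the generator nonzero. -/
theorem exists_eq_zmultiples {A : AddSubgroup ℝ} {N k : ℕ} (hN : 0 < N) (hk : 0 < k)
    (hA : ∀ s ∈ A, ∃ n : ℤ, N * s = n * Real.pi) (hkA : k * Real.pi ∈ A) :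
    ∃ φ : ℝ, 0 < φ ∧ A = AddSubgroup.zmultiples φ := by
  have hN' : (0 : ℝ) < N := Nat.cast_pos.2 hN
  have hπ := Real.pi_pos
  have hdisj : Disjoint (A : Set ℝ) (Set.Ioo 0 (Real.pi / N)) := by
    rw [Set.disjoint_left]
    rintro s hs ⟨h0, h1⟩
    obtain ⟨n, hn⟩ := hA s hs
    rw [lt_div_iff₀ hN', mul_comm] at h1
    have h2 : 0 < (N : ℝ) * s := mul_pos hN' h0
    rw [hn] at h1 h2
    have h3 : (n : ℝ) < 1 := by nlinarith
    have h4 : (0 : ℝ) < n := by nlinarith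
    have h5 : n < 1 := by exact_mod_cast h3
    have h6 : 0 < n := by exact_mod_cast h4
    omega
  obtain ⟨b, hb⟩ := AddSubgroup.cyclic_of_isolated_zero (by positivity) hdisj
  rw [← AddSubgroup.zmultiples_eq_closure] at hb
  have hb0 : b ≠ 0 := by
    rintro rfl
    rw [hb, AddSubgroup.zmultiples_zero_eq_bot, AddSubgroup.mem_bot] at hkA
    have : (0 : ℝ) < k * Real.pi := by positivity
    exact this.ne' hkA
  refine ⟨|b|, abs_pos.2 hb0, hb.trans ?_⟩
  rcases abs_choice b with h | h <;> rw [h]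
  rw [AddSubgroup.zmultiples_neg]

/-- The isotropy group lies in the cyclic group generated by the class of the rotation by `φ`, whose
`n`-th power is the rotation by `kπ` and so is trivial modulo the centre. -/
theorem isotropyOrder_dvd {Γ : Subgroup GTilde} {t : GTilde} {u : 𝔻} (ht : t • (0 : 𝔻) = u)
    {φ : ℝ} (hΓ : angles t Γ ≤ AddSubgroup.zmultiples φ) {n k : ℕ}
    (hn : (k : ℝ) * Real.pi = n * φ) : isotropyOrder Γ u ∣ n := by
  have h1 : isotropy Γ u ≤ Subgroup.zpowers (QuotientGroup.mk' Z (rotAt t φ)) := by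
    rintro _ ⟨g, ⟨hg, hgu⟩, rfl⟩
    obtain ⟨s, rfl⟩ := (smul_eq_iff ht).1 hgu
    obtain ⟨m, hm⟩ := AddSubgroup.mem_zmultiples_iff.1 (hΓ (mem_angles.2 hg))
    refine ⟨m, ?_⟩
    change _ ^ m = _
    rw [← map_zpow, ← rotAt_intCast_mul, ← zsmul_eq_mul, hm]
  refine (Subgroup.card_dvd_of_le h1).trans ?_
  rw [Nat.card_zpowers]
  apply orderOf_dvd_of_pow_eq_one
  rw [← map_pow, ← rotAt_natCast_mul, ← hn]
  exact (QuotientGroup.eq_one_iff _).2 (rotAt_mem_Z_iff.2 ⟨k, by simp⟩)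

/-! ### The set of products -/

/-- The groups `Γ₁`, `Γ₂` as seen from the point `u = t • 0`: the products of rotations about `u`
in the two groups are the rotations by the multiples of `φ`. -/
structure IsStep (Γ₁ Γ₂ : Subgroup GTilde) (u : 𝔻) (t : GTilde) (φ : ℝ) : Prop where
  smul_zero : t • (0 : 𝔻) = u
  pos : 0 < φ
  lt_pi : φ < Real.pi
  rotation₁ : ∀ g ∈ Γ₁, g • u = u → ∃ n : ℤ, g = rotAt t (n * φ)
  rotation₂ : ∀ g ∈ Γ₂, ∃ n : ℤ, g = rotAt t (n * φ)
  exists_mul : ∀ n : ℤ, ∃ g₁ ∈ Γ₁, ∃ g₂ ∈ Γ₂, g₁ • u = u ∧ rotAt t (n * φ) = g₁ * g₂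
  finite : ∀ K : Set GTilde, IsCompact K → (products Γ₁ Γ₂ ∩ K).Finite

theorem finite_inter_of_isCompact {Γ : Subgroup GTilde} (hΓ : DiscreteTopology Γ) {K : Set GTilde}
    (hK : IsCompact K) : ((Γ : Set GTilde) ∩ K).Finite := by
  have h := Γ.tendsto_coe_cofinite_of_discrete (isDiscrete_iff_discreteTopology.2 hΓ)
  have h1 := h hK.compl_mem_cocompact
  rw [Filter.mem_map, Filter.mem_cofinite] at h1
  refine (h1.image Subtype.val).subset ?_
  rintro g ⟨hg, hgK⟩
  exact ⟨⟨g, hg⟩, by simpa using hgK, rfl⟩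

/-- Since the rotation by `nφ` lies in `Γ₁`, reducing exponents modulo `n` covers `Γ₁Γ₂` by the
cosets of `Γ₁` of the rotations by `iφ`, `0 ≤ i < n`, and each coset meets a compact set in a finite
set. -/
theorem finite_products_inter {Γ₁ Γ₂ : Subgroup GTilde} (hΓ : DiscreteTopology Γ₁) {t : GTilde}
    {φ : ℝ} {n : ℕ} (hn : 0 < n) (hnφ : rotAt t (n * φ) ∈ Γ₁)
    (h₂ : ∀ g ∈ Γ₂, ∃ m : ℤ, g = rotAt t (m * φ)) {K : Set GTilde} (hK : IsCompact K) :
    (products Γ₁ Γ₂ ∩ K).Finite := by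
  have hfin : (⋃ i ∈ Finset.range n, (fun g => g * rotAt t ((i : ℕ) * φ)) ''
      ((Γ₁ : Set GTilde) ∩ (fun g => g * (rotAt t (i * φ))⁻¹) '' K)).Finite := by
    refine Set.Finite.biUnion (Finset.finite_toSet _) fun i _ => Set.Finite.image _ ?_
    exact finite_inter_of_isCompact hΓ (hK.image (continuous_mul_const _))
  refine hfin.subset ?_
  rintro _ ⟨⟨g₁, hg₁, g₂, hg₂, rfl⟩, hK'⟩
  obtain ⟨m, rfl⟩ := h₂ g₂ hg₂
  have hn0 : (n : ℤ) ≠ 0 := by omega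
  have hlt := Int.emod_lt_of_pos m (by omega : (0 : ℤ) < n)
  obtain ⟨i, hi⟩ := Int.eq_ofNat_of_zero_le (Int.emod_nonneg m hn0)
  have hm : m = n * (m / n) + i := by
    rw [← hi]; exact (Int.mul_ediv_add_emod m n).symm
  have hrot : rotAt t (m * φ) = rotAt t (n * φ) ^ (m / n) * rotAt t (i * φ) := by
    rw [← rotAt_intCast_mul, ← rotAt_add]
    congr 1
    have : (m : ℝ) = n * ((m / n : ℤ) : ℝ) + i := by exact_mod_cast hm
    linear_combination φ * this
  simp only [Set.mem_iUnion]
  refine ⟨i, Finset.mem_range.2 (by omega), g₁ * rotAt t (n * φ) ^ (m / n),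
    ⟨Γ₁.mul_mem hg₁ (Γ₁.zpow_mem hnφ _), ⟨_, hK', ?_⟩⟩, ?_⟩
  · change g₁ * rotAt t (m * φ) * (rotAt t (i * φ))⁻¹ = _
    rw [hrot]; group
  · change g₁ * rotAt t (n * φ) ^ (m / n) * rotAt t (i * φ) = _
    rw [hrot, mul_assoc]

theorem ConditionStar.exists_isStep {Γ₁ Γ₂ : Subgroup GTilde} {u : 𝔻} {k : ℕ}
    (h : ConditionStar Γ₁ Γ₂ u k) : ∃ t φ, IsStep Γ₁ Γ₂ u t φ := by
  obtain ⟨t, ht⟩ := exists_smul_zero_eq u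
  -- An infinite isotropy group has cardinality zero here, which would make the least common
  -- multiple zero; the inequality `p > k` rules this out.
  have hlcm : Nat.lcm (isotropyOrder Γ₁ u) (isotropyOrder Γ₂ u) ≠ 0 := by
    have := h.level_lt
    omega
  have hp₁ : isotropyOrder Γ₁ u ≠ 0 := fun h0 => hlcm (by rw [h0, Nat.lcm_zero_left])
  have hp₂ : isotropyOrder Γ₂ u ≠ 0 := fun h0 => hlcm (by rw [h0, Nat.lcm_zero_right])
  have hk₁ := level_mul_pi_mem_angles h.level₁ t
  have hA : ∀ s ∈ angles t Γ₁ ⊔ angles t Γ₂,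
      ∃ n : ℤ, (isotropyOrder Γ₁ u * isotropyOrder Γ₂ u : ℕ) * s = n * Real.pi := by
    intro s hs
    obtain ⟨s₁, hs₁, s₂, hs₂, rfl⟩ := AddSubgroup.mem_sup.1 hs
    obtain ⟨n₁, hn₁⟩ := isotropyOrder_mul_mem ht hs₁
    obtain ⟨n₂, hn₂⟩ := isotropyOrder_mul_mem ht hs₂
    refine ⟨isotropyOrder Γ₂ u * n₁ + isotropyOrder Γ₁ u * n₂, ?_⟩
    push_cast
    linear_combination (isotropyOrder Γ₂ u : ℝ) * hn₁ + (isotropyOrder Γ₁ u : ℝ) * hn₂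
  -- The step `φ` is the positive generator of the sum of the two groups of angles.
  obtain ⟨φ, hφ, hAφ⟩ := exists_eq_zmultiples (Nat.mul_pos (Nat.pos_of_ne_zero hp₁)
    (Nat.pos_of_ne_zero hp₂)) h.level_pos hA (AddSubgroup.mem_sup_left hk₁)
  have hkφ := AddSubgroup.mem_sup_left (T := angles t Γ₂) hk₁
  rw [hAφ, AddSubgroup.mem_zmultiples_iff] at hkφ
  obtain ⟨m, hm⟩ := hkφ
  rw [zsmul_eq_mul] at hm
  have hk0 : (0 : ℝ) < k := Nat.cast_pos.2 h.level_pos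
  have hπ := Real.pi_pos
  have hm0 : 0 < m := by
    have : (0 : ℝ) < m := by
      by_contra h0
      have h1 : (m : ℝ) * φ ≤ 0 := mul_nonpos_of_nonpos_of_nonneg (not_lt.1 h0) hφ.le
      have h2 : 0 < (k : ℝ) * Real.pi := by positivity
      linarith
    exact_mod_cast this
  lift m to ℕ using hm0.le
  have hm' : (k : ℝ) * Real.pi = m * φ := by rw [← hm]; simp
  have hm1 : 0 < m := by exact_mod_cast hm0
  -- From `kπ = mφ` and `p ∣ m` one gets `m ≥ p > k`, that is, `φ < π`.
  have hdvd : Nat.lcm (isotropyOrder Γ₁ u) (isotropyOrder Γ₂ u) ∣ m :=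
    Nat.lcm_dvd (isotropyOrder_dvd ht (hAφ ▸ le_sup_left) hm')
      (isotropyOrder_dvd ht (hAφ ▸ le_sup_right) hm')
  have hkm : k < m := h.level_lt.trans_le (Nat.le_of_dvd hm1 hdvd)
  have hmem : ∀ s, s ∈ angles t Γ₁ ⊔ angles t Γ₂ → ∃ n : ℤ, s = n * φ := by
    intro s hs
    rw [hAφ, AddSubgroup.mem_zmultiples_iff] at hs
    obtain ⟨n, hn⟩ := hs
    exact ⟨n, by rw [← hn, zsmul_eq_mul]⟩
  have hrot : ∀ Γ : Subgroup GTilde, angles t Γ ≤ angles t Γ₁ ⊔ angles t Γ₂ →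
      ∀ g ∈ Γ, g • u = u → ∃ n : ℤ, g = rotAt t (n * φ) := by
    intro Γ hΓ g hg hgu
    obtain ⟨s, rfl⟩ := (smul_eq_iff ht).1 hgu
    obtain ⟨n, hn⟩ := hmem s (hΓ (mem_angles.2 hg))
    exact ⟨n, by rw [hn]⟩
  have hrot₂ : ∀ g ∈ Γ₂, ∃ n : ℤ, g = rotAt t (n * φ) := fun g hg =>
    hrot Γ₂ le_sup_right g hg (smul_eq_of_isCyclic h.cyclic₂ h.fixed₂ hg)
  refine ⟨t, φ, ht, hφ, ?_, hrot Γ₁ le_sup_left, hrot₂, ?_, fun K hK =>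
    finite_products_inter h.discrete₁ hm1 (hm' ▸ hk₁) hrot₂ hK⟩
  · have : (k : ℝ) < m := by exact_mod_cast hkm
    by_contra h0
    have h1 : (m : ℝ) * Real.pi ≤ m * φ := mul_le_mul_of_nonneg_left (not_lt.1 h0) (by positivity)
    nlinarith
  · intro n
    have hn : (n : ℝ) * φ ∈ angles t Γ₁ ⊔ angles t Γ₂ := by
      rw [hAφ, ← zsmul_eq_mul]
      exact AddSubgroup.zsmul_mem_zmultiples _ _
    obtain ⟨s₁, hs₁, s₂, hs₂, hs⟩ := AddSubgroup.mem_sup.1 hn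
    exact ⟨rotAt t s₁, hs₁, rotAt t s₂, hs₂, rotAt_smul ht s₁, by rw [← hs, rotAt_add]⟩

/-! ### The function describing a prism -/

/-- The maximum of the truncated linear functions of the rotations about `t • 0` by the multiples
of `φ`; the prism of the point `t • 0` consists of the points where it is at most one. -/
def prismFn (t : GTilde) (φ : ℝ) (y : LTilde) : ℝ :=
  ((t : LTilde)⁻¹ * y * t).r * Real.cos ‖((((t : LTilde)⁻¹ * y * t).arg : ℝ) : AddCircle φ)‖

theorem continuous_conj_arg (t : LTilde) : Continuous fun y : LTilde => (t⁻¹ * y * t).arg :=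
  Continuous.comp (g := LTilde.arg) LTilde.continuous_arg
    ((continuous_const_mul t⁻¹).mul continuous_const)

theorem continuous_conj_r (t : LTilde) : Continuous fun y : LTilde => (t⁻¹ * y * t).r :=
  Continuous.comp (g := LTilde.r) LTilde.continuous_r
    ((continuous_const_mul t⁻¹).mul continuous_const)

theorem continuous_prismFn (t : GTilde) (φ : ℝ) : Continuous (prismFn t φ) := by
  refine (continuous_conj_r t).mul (Real.continuous_cos.comp (continuous_norm.comp ?_))
  exact (AddCircle.continuous_mk' φ).comp (continuous_conj_arg t)

theorem prismFn_scale (t : GTilde) (φ s : ℝ) (y : LTilde) :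
    prismFn t φ (scale s y) = Real.exp s * prismFn t φ y := by
  rw [prismFn, prismFn, mul_scale, scale_mul, scale_r, scale_arg, mul_assoc]

theorem inv_mul_inv_rotAt_mul (t : GTilde) (s : ℝ) (y : LTilde) :
    (t : LTilde)⁻¹ * ((rotAt t s : LTilde)⁻¹ * y) * t =
      (rot (-s) : LTilde) * ((t : LTilde)⁻¹ * y * t) := by
  rw [rot_neg, rotAt]
  push_cast
  group

/-- Conjugation moves the centre of rotation to the origin, where a rotation only shifts the
argument. -/
theorem weight_inv_rotAt_mul (t : GTilde) (s : ℝ) (y : LTilde) :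
    weight ((rotAt t s : LTilde)⁻¹ * y) =
      ((t : LTilde)⁻¹ * y * t).r *
        Real.cos (min |((t : LTilde)⁻¹ * y * t).arg - s| (Real.pi / 2)) := by
  have h := weight_conj t⁻¹ ((rotAt t s : LTilde)⁻¹ * y)
  rw [Subgroup.coe_inv, inv_inv, inv_mul_inv_rotAt_mul] at h
  rw [← h, weight, rot_mul_r, rot_mul_arg, neg_add_eq_sub]

theorem norm_coe_sub_int_mul (φ α : ℝ) (n : ℤ) :
    ‖((α - n * φ : ℝ) : AddCircle φ)‖ = ‖(α : AddCircle φ)‖ := by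
  rw [AddCircle.coe_sub, ← zsmul_eq_mul, AddCircle.coe_zsmul, AddCircle.coe_period, smul_zero,
    sub_zero]

theorem prismFn_inv_rotAt_mul (t : GTilde) (φ : ℝ) (n : ℤ) (y : LTilde) :
    prismFn t φ ((rotAt t (n * φ) : LTilde)⁻¹ * y) = prismFn t φ y := by
  rw [prismFn, prismFn, inv_mul_inv_rotAt_mul, rot_mul_r, rot_mul_arg, neg_add_eq_sub,
    norm_coe_sub_int_mul]

/-! ### The prism function as a maximum of weights, for a step `0 < φ < π` -/

section Step

variable {t : GTilde} {φ : ℝ}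

theorem norm_coe_le_half (hφ : 0 < φ) (x : AddCircle φ) : ‖x‖ ≤ φ / 2 := by
  have := AddCircle.norm_le_half_period φ hφ.ne' (x := x)
  rwa [abs_of_pos hφ] at this

theorem cos_norm_ge (hφ : 0 < φ) (hφπ : φ < Real.pi) (x : AddCircle φ) :
    Real.cos (φ / 2) ≤ Real.cos ‖x‖ :=
  Real.cos_le_cos_of_nonneg_of_le_pi (norm_nonneg _) (by linarith) (norm_coe_le_half hφ x)

theorem cos_half_pos (hφ : 0 < φ) (hφπ : φ < Real.pi) : 0 < Real.cos (φ / 2) :=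
  Real.cos_pos_of_mem_Ioo ⟨by linarith, by linarith⟩

theorem prismFn_pos (hφ : 0 < φ) (hφπ : φ < Real.pi) (y : LTilde) : 0 < prismFn t φ y :=
  mul_pos (r_pos _) ((cos_half_pos hφ hφπ).trans_le (cos_norm_ge hφ hφπ _))

/-- The distance from `α` to `φℤ` is at most `|α - nφ|` and at most `φ/2 < π/2`, and the cosine
decreases on `[0, π]`. -/
theorem weight_le_prismFn (hφ : 0 < φ) (hφπ : φ < Real.pi) (n : ℤ) (y : LTilde) :
    weight ((rotAt t (n * φ) : LTilde)⁻¹ * y) ≤ prismFn t φ y := by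
  rw [weight_inv_rotAt_mul, prismFn]
  refine mul_le_mul_of_nonneg_left ?_ (r_pos _).le
  refine Real.cos_le_cos_of_nonneg_of_le_pi (norm_nonneg _)
    ((min_le_right _ _).trans (by linarith)) (le_min ?_ ?_)
  · rw [← norm_coe_sub_int_mul φ _ n]
    exact QuotientAddGroup.norm_mk_le_norm
  · linarith [norm_coe_le_half hφ ((((t : LTilde)⁻¹ * y * t).arg : ℝ) : AddCircle φ)]

theorem prismFn_eq_weight (hφ : 0 < φ) (hφπ : φ < Real.pi) {y : LTilde}
    (hy : |((t : LTilde)⁻¹ * y * t).arg| ≤ φ / 2) : prismFn t φ y = weight y := by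
  have h := weight_inv_rotAt_mul t 0 y
  rw [rotAt_zero, Subgroup.coe_one, inv_one, one_mul, sub_zero, min_eq_left (by linarith)] at h
  rw [h, prismFn, (AddCircle.norm_coe_eq_abs_iff φ hφ.ne').2 (by rwa [abs_of_pos hφ])]

theorem exists_rotAt_abs_arg_le (hφ : 0 < φ) (y : LTilde) :
    ∃ n : ℤ, |((t : LTilde)⁻¹ * ((rotAt t (n * φ) : LTilde)⁻¹ * y) * t).arg| ≤ φ / 2 := by
  refine ⟨round (φ⁻¹ * ((t : LTilde)⁻¹ * y * t).arg), ?_⟩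
  rw [inv_mul_inv_rotAt_mul, rot_mul_arg, neg_add_eq_sub, ← AddCircle.norm_eq]
  exact norm_coe_le_half hφ _

/-- The maximum of the weights is attained at the multiple of `φ` nearest to the argument. -/
theorem prismFn_le_iff (hφ : 0 < φ) (hφπ : φ < Real.pi) {y : LTilde} {c : ℝ} :
    prismFn t φ y ≤ c ↔ ∀ n : ℤ, weight ((rotAt t (n * φ) : LTilde)⁻¹ * y) ≤ c := by
  refine ⟨fun h n => (weight_le_prismFn hφ hφπ n y).trans h, fun h => ?_⟩
  obtain ⟨n, hn⟩ := exists_rotAt_abs_arg_le (t := t) hφ y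
  rw [← prismFn_inv_rotAt_mul t φ n, prismFn_eq_weight hφ hφπ hn]
  exact h n

end Step

/-! ### The cells -/

/-- The set of all `a` such that `h⁻¹ a` lies over the facet of the prism of `t • 0` that belongs
to the unit and the function of this prism is at most `c` there. -/
def cell (t : GTilde) (φ c : ℝ) (h : GTilde) : Set GTilde :=
  {a | |((t : LTilde)⁻¹ * ((h : LTilde)⁻¹ * a) * t).arg| ≤ φ / 2 ∧
    prismFn t φ ((h : LTilde)⁻¹ * a) ≤ c}

theorem continuous_prismFn_coe (t h : GTilde) (φ : ℝ) :
    Continuous fun a : GTilde => prismFn t φ ((h : LTilde)⁻¹ * a) :=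
  (continuous_prismFn t φ).comp ((continuous_const_mul (h : LTilde)⁻¹).comp continuous_subtype_val)

theorem continuous_conj_arg_coe (t h : GTilde) :
    Continuous fun a : GTilde => ((t : LTilde)⁻¹ * ((h : LTilde)⁻¹ * a) * t).arg :=
  (continuous_conj_arg t).comp ((continuous_const_mul (h : LTilde)⁻¹).comp continuous_subtype_val)

theorem continuous_weight_coe (h : GTilde) :
    Continuous fun a : GTilde => weight ((h : LTilde)⁻¹ * a) :=
  (continuous_weight_inv_mul (h : LTilde)).comp continuous_subtype_val

theorem isClosed_cell (t : GTilde) (φ c : ℝ) (h : GTilde) : IsClosed (cell t φ c h) :=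
  (isClosed_le (continuous_conj_arg_coe t h).abs continuous_const).inter
    (isClosed_le (continuous_prismFn_coe t h φ) continuous_const)

/-- In coordinates centred at `t • 0` the argument is bounded by `φ/2`, and `|z| < r ≤ c /
cos(φ/2)`. The last bound needs `φ < π`. -/
theorem isCompact_cell_one (t : GTilde) {φ : ℝ} (hφ : 0 < φ) (hφπ : φ < Real.pi) (c : ℝ) :
    IsCompact (cell t φ c 1) := by
  have hK : IsCompact ((fun x => t * ofCoord x * t⁻¹) ''
      (Metric.closedBall (0 : ℂ) (c / Real.cos (φ / 2)) ×ˢ Set.Icc (-(φ / 2)) (φ / 2))) := by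
    refine ((isCompact_closedBall _ _).prod isCompact_Icc).image ?_
    exact (continuous_const.mul continuous_ofCoord).mul continuous_const
  refine hK.of_isClosed_subset (isClosed_cell t φ c 1) ?_
  rintro a ⟨h1, h2⟩
  have e : (t : LTilde)⁻¹ * (((1 : GTilde) : LTilde)⁻¹ * a) * t = (t⁻¹ * a * t : GTilde) := by
    push_cast; rw [inv_one, one_mul]
  rw [prismFn] at h2
  rw [e] at h1 h2
  refine ⟨coord (t⁻¹ * a * t), ⟨?_, abs_le.1 h1⟩, ?_⟩
  · rw [mem_closedBall_zero_iff, le_div_iff₀ (cos_half_pos hφ hφπ)]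
    refine le_trans ?_ h2
    exact mul_le_mul (norm_lt ((t⁻¹ * a * t : GTilde) : LTilde)).le (cos_norm_ge hφ hφπ _) (cos_half_pos hφ hφπ).le (r_pos _).le
  · change t * ofCoord (coord (t⁻¹ * a * t)) * t⁻¹ = a
    rw [ofCoord_coord]; group

theorem mem_cell_iff {t h a : GTilde} {φ c : ℝ} : a ∈ cell t φ c h ↔ h⁻¹ * a ∈ cell t φ c 1 := by
  simp only [cell, Set.mem_ofPred_eq, Subgroup.coe_mul, Subgroup.coe_inv, Subgroup.coe_one, inv_one,
    one_mul]

namespace IsStep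

variable {Γ₁ Γ₂ : Subgroup GTilde} {u : 𝔻} {t : GTilde} {φ : ℝ}

theorem mem_products_mul (hst : IsStep Γ₁ Γ₂ u t φ) {h : GTilde} (hh : h ∈ products Γ₁ Γ₂) (n : ℤ) :
    h * rotAt t (n * φ) ∈ products Γ₁ Γ₂ := by
  obtain ⟨g₁, hg₁, g₂, hg₂, rfl⟩ := hh
  obtain ⟨m, rfl⟩ := hst.rotation₂ g₂ hg₂
  obtain ⟨h₁, hh₁, h₂, hh₂, -, e⟩ := hst.exists_mul (m + n)
  refine ⟨g₁ * h₁, Γ₁.mul_mem hg₁ hh₁, h₂, hh₂, ?_⟩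
  rw [mul_assoc, mul_assoc, ← e, ← rotAt_add]
  congr 2
  push_cast; ring

theorem one_mem_products (Γ₁ Γ₂ : Subgroup GTilde) : (1 : GTilde) ∈ products Γ₁ Γ₂ :=
  ⟨1, Γ₁.one_mem, 1, Γ₂.one_mem, by simp⟩

/-- If the cell of `h` meets the compact set `K`, then `h` lies in the compact set `K · (cell t φ c
1)⁻¹`. -/
theorem locallyFinite_cell (hst : IsStep Γ₁ Γ₂ u t φ) (c : ℝ) :
    LocallyFinite fun h : products Γ₁ Γ₂ => cell t φ c h := by
  intro a
  obtain ⟨K, hK, haK⟩ := exists_compact_mem_nhds a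
  refine ⟨K, haK, ?_⟩
  have hfin := hst.finite _ (hK.mul (isCompact_cell_one t hst.pos hst.lt_pi c).inv)
  refine (hfin.preimage Subtype.val_injective.injOn).subset ?_
  rintro h ⟨b, hb, hbK⟩
  refine ⟨h.2, Set.mem_mul.2 ⟨b, hbK, (h.1⁻¹ * b)⁻¹, Set.inv_mem_inv.2 (mem_cell_iff.1 hb), ?_⟩⟩
  group

/-- Multiplying `h` on the right by a rotation by a multiple of `φ` keeps it in `Γ₁Γ₂` and keeps its
prism; a suitable multiple puts `a` over the facet of the new element. -/
theorem exists_mem_cell (hst : IsStep Γ₁ Γ₂ u t φ) {h : GTilde} (hh : h ∈ products Γ₁ Γ₂)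
    (a : GTilde) : ∃ h' ∈ products Γ₁ Γ₂, a ∈ cell t φ (prismFn t φ ((h : LTilde)⁻¹ * a)) h' := by
  obtain ⟨n, hn⟩ := exists_rotAt_abs_arg_le (t := t) hst.pos ((h : LTilde)⁻¹ * a)
  have e : ((h * rotAt t (n * φ) : GTilde) : LTilde)⁻¹ * a =
      (rotAt t (n * φ) : LTilde)⁻¹ * ((h : LTilde)⁻¹ * a) := by
    push_cast; group
  refine ⟨_, hst.mem_products_mul hh n, ?_, ?_⟩
  · rwa [e]
  · rw [e, prismFn_inv_rotAt_mul]

end IsStep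

/-! ### The minimum of the prism functions -/

/-- The infimum of the functions of all prisms, on `G̃`. -/
def minFn (Γ₁ Γ₂ : Subgroup GTilde) (t : GTilde) (φ : ℝ) (a : GTilde) : ℝ :=
  ⨅ h : products Γ₁ Γ₂, prismFn t φ ((h : LTilde)⁻¹ * a)

namespace IsStep

variable {Γ₁ Γ₂ : Subgroup GTilde} {u : 𝔻} {t : GTilde} {φ : ℝ}

theorem minFn_le (hst : IsStep Γ₁ Γ₂ u t φ) {h : GTilde} (hh : h ∈ products Γ₁ Γ₂) (a : GTilde) :
    minFn Γ₁ Γ₂ t φ a ≤ prismFn t φ ((h : LTilde)⁻¹ * a) :=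
  ciInf_le (f := fun h : products Γ₁ Γ₂ => prismFn t φ ((h : LTilde)⁻¹ * a))
    ⟨0, by rintro _ ⟨h, rfl⟩; exact (prismFn_pos hst.pos hst.lt_pi _).le⟩ ⟨h, hh⟩

/-- Values above the value `c` at the unit do not matter, and every value up to `c` is bounded below
by that of one of the finitely many cells of level `c` containing `a`. -/
theorem exists_minFn_eq (hst : IsStep Γ₁ Γ₂ u t φ) (a : GTilde) :
    ∃ h ∈ products Γ₁ Γ₂, a ∈ cell t φ (minFn Γ₁ Γ₂ t φ a) h := by
  have h1 := one_mem_products Γ₁ Γ₂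
  set c := prismFn t φ (((1 : GTilde) : LTilde)⁻¹ * a) with hc
  have hfin : {h : products Γ₁ Γ₂ | a ∈ cell t φ c h}.Finite := (hst.locallyFinite_cell c).point_finite a
  obtain ⟨h0, hh0, hmem0⟩ := hst.exists_mem_cell h1 a
  obtain ⟨h, hh, hmin⟩ := Set.exists_min_image _
    (fun h : products Γ₁ Γ₂ => prismFn t φ ((h : LTilde)⁻¹ * a)) hfin ⟨⟨h0, hh0⟩, hmem0⟩
  have hh' : a ∈ cell t φ c h := hh
  refine ⟨h, h.2, hh'.1, ?_⟩
  have : Nonempty (products Γ₁ Γ₂) := ⟨⟨1, h1⟩⟩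
  refine le_ciInf fun h' => ?_
  obtain ⟨h'', hh'', hmem⟩ := hst.exists_mem_cell h'.2 a
  rcases le_total (prismFn t φ ((h' : LTilde)⁻¹ * a)) c with hle | hle
  · exact (hmin ⟨h'', hh''⟩ ⟨hmem.1, hmem.2.trans hle⟩).trans hmem.2
  · exact hh'.2.trans hle

theorem minFn_le_iff (hst : IsStep Γ₁ Γ₂ u t φ) {a : GTilde} {c : ℝ} :
    minFn Γ₁ Γ₂ t φ a ≤ c ↔ ∃ h ∈ products Γ₁ Γ₂, prismFn t φ ((h : LTilde)⁻¹ * a) ≤ c := by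
  constructor
  · intro hc
    obtain ⟨h, hh, hmem⟩ := hst.exists_minFn_eq a
    exact ⟨h, hh, hmem.2.trans hc⟩
  · rintro ⟨h, hh, hc⟩
    exact (hst.minFn_le hh a).trans hc

theorem minFn_le_iff_mem_cell (hst : IsStep Γ₁ Γ₂ u t φ) {a : GTilde} {c : ℝ} :
    minFn Γ₁ Γ₂ t φ a ≤ c ↔ a ∈ ⋃ h : products Γ₁ Γ₂, cell t φ c h := by
  rw [Set.mem_iUnion]
  constructor
  · intro hc
    obtain ⟨h, hh, hmem⟩ := hst.exists_minFn_eq a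
    exact ⟨⟨h, hh⟩, hmem.1, hmem.2.trans hc⟩
  · rintro ⟨h, hmem⟩
    exact (hst.minFn_le h.2 a).trans hmem.2

theorem minFn_pos (hst : IsStep Γ₁ Γ₂ u t φ) (a : GTilde) : 0 < minFn Γ₁ Γ₂ t φ a := by
  obtain ⟨h, hh, hmem⟩ := hst.exists_minFn_eq a
  exact (prismFn_pos hst.pos hst.lt_pi _).trans_le hmem.2

/-- Closed sublevel sets are locally finite unions of closed cells, and strict sublevel sets are
unions of open sets. -/
theorem continuous_minFn (hst : IsStep Γ₁ Γ₂ u t φ) : Continuous (minFn Γ₁ Γ₂ t φ) := by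
  rw [continuous_iff_lower_upperSemicontinuous, lowerSemicontinuous_iff_isClosed_preimage,
    upperSemicontinuous_iff_isOpen_preimage]
  constructor
  · intro c
    have : minFn Γ₁ Γ₂ t φ ⁻¹' Set.Iic c = ⋃ h : products Γ₁ Γ₂, cell t φ c h := by
      ext a; exact hst.minFn_le_iff_mem_cell
    rw [this]
    exact (hst.locallyFinite_cell c).isClosed_iUnion fun h => isClosed_cell t φ c h
  · intro c
    have : minFn Γ₁ Γ₂ t φ ⁻¹' Set.Iio c =
        ⋃ h : products Γ₁ Γ₂, {a : GTilde | prismFn t φ ((h : LTilde)⁻¹ * a) < c} := by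
      ext a
      rw [Set.mem_iUnion]
      constructor
      · intro (hc : minFn Γ₁ Γ₂ t φ a < c)
        obtain ⟨h, hh, hmem⟩ := hst.exists_minFn_eq a
        exact ⟨⟨h, hh⟩, hmem.2.trans_lt hc⟩
      · rintro ⟨h, hc⟩
        exact (hst.minFn_le h.2 a).trans_lt hc
    rw [this]
    exact isOpen_iUnion fun h => isOpen_lt (continuous_prismFn_coe t h φ) continuous_const

end IsStep

/-! ### The two-sided action -/

theorem smul_LTilde (γ : GTilde × GTilde) (y : LTilde) :
    γ • y = (γ.1 : LTilde) * y * (γ.2 : LTilde)⁻¹ := rfl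

theorem smul_GTilde (γ : GTilde × GTilde) (a : GTilde) : γ • a = γ.1 * a * γ.2⁻¹ := rfl

instance : ContinuousConstSMul (GTilde × GTilde) GTilde where
  continuous_const_smul γ := (continuous_const_mul γ.1).mul continuous_const

theorem height_smul (γ : GTilde × GTilde) (y : LTilde) : height (γ • y) = height y := by
  have h : ((γ.2 : LTilde)⁻¹).det = 1 := (γ.2⁻¹).2
  rw [height, height, smul_LTilde, det_mul, det_mul, det_coe, h, one_mul, mul_one]

theorem coe_smul_GTilde (γ : GTilde × GTilde) (a : GTilde) :
    ((γ • a : GTilde) : LTilde) = γ • (a : LTilde) := rfl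

theorem smul_scale (γ : GTilde × GTilde) (s : ℝ) (y : LTilde) :
    γ • scale s y = scale s (γ • y) := by
  rw [smul_LTilde, smul_LTilde, mul_scale, scale_mul]

theorem theta_smul (γ : GTilde × GTilde) (y : LTilde) : theta (γ • y) = γ • theta y := by
  apply Subtype.ext
  rw [coe_theta, coe_smul_GTilde, coe_theta, height_smul, smul_scale]

theorem weight_smul (γ : GTilde × GTilde) (g : GTilde) (y : LTilde) :
    weight (((γ • g : GTilde) : LTilde)⁻¹ * γ • y) = weight ((g : LTilde)⁻¹ * y) := by
  rw [← weight_conj γ.2 ((g : LTilde)⁻¹ * y), coe_smul_GTilde, smul_LTilde, smul_LTilde]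
  congr 1
  group

theorem smul_mem_products {Γ₁ Γ₂ : Subgroup GTilde} {γ : GTilde × GTilde} (hγ : γ ∈ Γ₁.prod Γ₂)
    {h : GTilde} (hh : h ∈ products Γ₁ Γ₂) : γ • h ∈ products Γ₁ Γ₂ := by
  obtain ⟨g₁, hg₁, g₂, hg₂, rfl⟩ := hh
  obtain ⟨hγ₁, hγ₂⟩ := Subgroup.mem_prod.1 hγ
  refine ⟨γ.1 * g₁, Γ₁.mul_mem hγ₁ hg₁, g₂ * γ.2⁻¹, Γ₂.mul_mem hg₂ (Γ₂.inv_mem hγ₂), ?_⟩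
  rw [smul_GTilde]; group

theorem exists_smul_eq {Γ₁ Γ₂ : Subgroup GTilde} {g h : GTilde} (hg : g ∈ products Γ₁ Γ₂)
    (hh : h ∈ products Γ₁ Γ₂) : ∃ γ ∈ Γ₁.prod Γ₂, γ • g = h := by
  obtain ⟨g₁, hg₁, g₂, hg₂, rfl⟩ := hg
  obtain ⟨h₁, hh₁, h₂, hh₂, rfl⟩ := hh
  refine ⟨(h₁ * g₁⁻¹, h₂⁻¹ * g₂), Subgroup.mem_prod.2
    ⟨Γ₁.mul_mem hh₁ (Γ₁.inv_mem hg₁), Γ₂.mul_mem (Γ₂.inv_mem hh₂) hg₂⟩, ?_⟩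
  rw [smul_GTilde]; group

theorem mul_rot_arg (a : LTilde) (s : ℝ) : (a * (rot s : LTilde)).arg = a.arg + s := by
  rw [mul_arg, rot_arg, twist, rot_z]; simp

theorem mul_rot_r (a : LTilde) (s : ℝ) : (a * (rot s : LTilde)).r = a.r := by
  rw [mul_r, rot_z, rot_w, mul_zero, add_zero, norm_mul, Complex.norm_exp_ofReal_mul_I,
    mul_one, norm_w]

/-- This periodicity on the right makes the minimum invariant under `Γ₂`, whose elements are all
rotations of this kind. -/
theorem prismFn_mul_inv_rotAt (t : GTilde) (φ : ℝ) (n : ℤ) (y : LTilde) :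
    prismFn t φ (y * (rotAt t (n * φ) : LTilde)⁻¹) = prismFn t φ y := by
  have e : (t : LTilde)⁻¹ * (y * (rotAt t (n * φ) : LTilde)⁻¹) * t =
      ((t : LTilde)⁻¹ * y * t) * (rot (-(n * φ)) : LTilde) := by
    rw [rot_neg, rotAt]
    push_cast
    group
  rw [prismFn, prismFn, e, mul_rot_r, mul_rot_arg, ← sub_eq_add_neg, norm_coe_sub_int_mul]

/-! ### The polytope and its boundary -/

/-- The homogeneous function whose sublevel set is the polytope. -/
def gauge (Γ₁ Γ₂ : Subgroup GTilde) (t : GTilde) (φ : ℝ) (y : LTilde) : ℝ :=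
  Real.exp (height y) * minFn Γ₁ Γ₂ t φ (theta y)

/-- The set of the points of `G̃` over which the hypersurface `∂H_h` meets the boundary of the
polytope. -/
def touch (Γ₁ Γ₂ : Subgroup GTilde) (t : GTilde) (φ : ℝ) (h : GTilde) : Set GTilde :=
  {a | weight ((h : LTilde)⁻¹ * a) = minFn Γ₁ Γ₂ t φ a}

theorem prismFn_eq_exp_mul (t : GTilde) (φ : ℝ) (h y : LTilde) :
    prismFn t φ (h⁻¹ * y) = Real.exp (height y) * prismFn t φ (h⁻¹ * (theta y : LTilde)) := by
  rw [← prismFn_scale, ← mul_scale, scale_theta]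

theorem weight_eq_exp_mul (h y : LTilde) :
    weight (h⁻¹ * y) = Real.exp (height y) * weight (h⁻¹ * (theta y : LTilde)) := by
  rw [← weight_scale, ← mul_scale, scale_theta]

namespace IsStep

variable {Γ₁ Γ₂ : Subgroup GTilde} {u : 𝔻} {t : GTilde} {φ : ℝ}

theorem minFn_smul_le (hst : IsStep Γ₁ Γ₂ u t φ) {γ : GTilde × GTilde} (hγ : γ ∈ Γ₁.prod Γ₂)
    (a : GTilde) : minFn Γ₁ Γ₂ t φ (γ • a) ≤ minFn Γ₁ Γ₂ t φ a := by
  obtain ⟨h, hh, hmem⟩ := hst.exists_minFn_eq a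
  obtain ⟨hγ₁, hγ₂⟩ := Subgroup.mem_prod.1 hγ
  have hh' : γ.1 * h ∈ products Γ₁ Γ₂ := by
    have := smul_mem_products (γ := (γ.1, 1)) (Subgroup.mem_prod.2 ⟨hγ₁, Γ₂.one_mem⟩) hh
    rwa [smul_GTilde, inv_one, mul_one] at this
  refine (hst.minFn_le hh' _).trans (le_trans (le_of_eq ?_) hmem.2)
  obtain ⟨n, hn⟩ := hst.rotation₂ γ.2 hγ₂
  rw [← prismFn_mul_inv_rotAt t φ n ((h : LTilde)⁻¹ * a), ← hn, coe_smul_GTilde, smul_LTilde]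
  congr 1
  push_cast
  group

theorem minFn_smul (hst : IsStep Γ₁ Γ₂ u t φ) {γ : GTilde × GTilde} (hγ : γ ∈ Γ₁.prod Γ₂)
    (a : GTilde) : minFn Γ₁ Γ₂ t φ (γ • a) = minFn Γ₁ Γ₂ t φ a := by
  refine le_antisymm (hst.minFn_smul_le hγ a) ?_
  have := hst.minFn_smul_le (inv_mem hγ) (γ • a)
  rwa [inv_smul_smul] at this

/-- Elements of `Γ₁` with the same value at `u` differ by a rotation about `u`, so the products
`g₁g₂` in the definition of the prism are exactly `g` times the rotations by multiples of `φ`. -/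
theorem Q_eq (hst : IsStep Γ₁ Γ₂ u t φ) {g : GTilde} (hg : g ∈ Γ₁) :
    Q Γ₁ Γ₂ u (g • u) = {y | prismFn t φ ((g : LTilde)⁻¹ * y) ≤ 1} := by
  ext y
  simp only [Q, Set.mem_iInter, H_eq, Set.mem_ofPred_eq, prismFn_le_iff hst.pos hst.lt_pi]
  constructor
  · intro h n
    obtain ⟨g₁, hg₁, g₂, hg₂, hu, e⟩ := hst.exists_mul n
    have h1 := h (g * g₁) (Γ₁.mul_mem hg hg₁) g₂ hg₂ (by rw [mul_smul, hu])
    rw [mul_assoc, ← e] at h1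
    convert h1 using 2
    push_cast
    group
  · intro h g₁ hg₁ g₂ hg₂ hu
    obtain ⟨n, hn⟩ := hst.rotation₁ (g⁻¹ * g₁) (Γ₁.mul_mem (Γ₁.inv_mem hg) hg₁)
      (by rw [mul_smul, hu, inv_smul_smul])
    obtain ⟨m, rfl⟩ := hst.rotation₂ g₂ hg₂
    have e : g₁ * rotAt t (m * φ) = g * rotAt t ((n + m : ℤ) * φ) := by
      rw [inv_mul_eq_iff_eq_mul.1 hn, mul_assoc, ← rotAt_add]
      congr 2
      push_cast; ring
    rw [e]
    convert h (n + m) using 2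
    push_cast
    group

/-- The prisms are indexed by the orbit of `Γ₁`. Letting `h` range over `Γ₁Γ₂` adds nothing, since a
factor from `Γ₂` does not change the prism function. -/
theorem mem_P_iff (hst : IsStep Γ₁ Γ₂ u t φ) {y : LTilde} :
    y ∈ P Γ₁ Γ₂ u ↔ ∃ h ∈ products Γ₁ Γ₂, prismFn t φ ((h : LTilde)⁻¹ * y) ≤ 1 := by
  rw [P, Set.mem_iUnion₂]
  constructor
  · rintro ⟨_, ⟨g, hg, rfl⟩, hy⟩
    rw [hst.Q_eq hg] at hy
    exact ⟨g, ⟨g, hg, 1, Γ₂.one_mem, (mul_one g).symm⟩, hy⟩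
  · rintro ⟨_, ⟨g₁, hg₁, g₂, hg₂, rfl⟩, hy⟩
    refine ⟨g₁ • u, ⟨g₁, hg₁, rfl⟩, ?_⟩
    rw [hst.Q_eq hg₁, Set.mem_ofPred_eq]
    obtain ⟨n, rfl⟩ := hst.rotation₂ g₂ hg₂
    rw [← prismFn_inv_rotAt_mul t φ n]
    convert hy using 2
    push_cast
    group

theorem P_eq (hst : IsStep Γ₁ Γ₂ u t φ) : P Γ₁ Γ₂ u = {y | gauge Γ₁ Γ₂ t φ y ≤ 1} := by
  ext y
  rw [hst.mem_P_iff, Set.mem_ofPred_eq, gauge, mul_comm, ← le_div_iff₀ (Real.exp_pos _),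
    hst.minFn_le_iff]
  refine exists_congr fun h => and_congr_right fun _ => ?_
  rw [le_div_iff₀ (Real.exp_pos _), prismFn_eq_exp_mul, mul_comm]

theorem continuous_gauge (hst : IsStep Γ₁ Γ₂ u t φ) : Continuous (gauge Γ₁ Γ₂ t φ) :=
  (Real.continuous_exp.comp continuous_height).mul (hst.continuous_minFn.comp continuous_theta)

theorem gauge_scale_coe (s : ℝ) (a : GTilde) :
    gauge Γ₁ Γ₂ t φ (scale s a) = Real.exp s * minFn Γ₁ Γ₂ t φ a := by
  rw [gauge, height_scale, theta_scale]

theorem gauge_scale (s : ℝ) (y : LTilde) :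
    gauge Γ₁ Γ₂ t φ (scale s y) = Real.exp s * gauge Γ₁ Γ₂ t φ y := by
  rw [← scale_theta y, scale_scale, gauge_scale_coe, gauge_scale_coe, Real.exp_add, mul_assoc]

theorem dP_eq (hst : IsStep Γ₁ Γ₂ u t φ) : dP Γ₁ Γ₂ u = {y | gauge Γ₁ Γ₂ t φ y = 1} := by
  rw [dP, hst.P_eq, frontier_le_one hst.continuous_gauge gauge_scale]

theorem mem_dP_iff (hst : IsStep Γ₁ Γ₂ u t φ) {y : LTilde} :
    y ∈ dP Γ₁ Γ₂ u ↔ gauge Γ₁ Γ₂ t φ y = 1 := by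
  rw [hst.dP_eq, Set.mem_ofPred_eq]

theorem smul_mem_dP (hst : IsStep Γ₁ Γ₂ u t φ) {γ : GTilde × GTilde} (hγ : γ ∈ Γ₁.prod Γ₂)
    {y : LTilde} (hy : y ∈ dP Γ₁ Γ₂ u) : γ • y ∈ dP Γ₁ Γ₂ u := by
  rw [hst.mem_dP_iff] at hy ⊢
  rwa [gauge, height_smul, theta_smul, hst.minFn_smul hγ]

/-- The restriction of `θ` to the boundary of the polytope. -/
def homeomorph (hst : IsStep Γ₁ Γ₂ u t φ) : dP Γ₁ Γ₂ u ≃ₜ GTilde where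
  toFun y := theta y
  -- The gauge on the ray over `a` is `eˢ` times the minimum at `a`, so it equals one exactly for `s
  -- = -log` of that minimum.
  invFun a := ⟨scale (-Real.log (minFn Γ₁ Γ₂ t φ a)) a, by
    rw [hst.mem_dP_iff, gauge_scale_coe, Real.exp_neg, Real.exp_log (hst.minFn_pos a)]
    exact inv_mul_cancel₀ (hst.minFn_pos a).ne'⟩
  left_inv y := by
    apply Subtype.ext
    have hy := hst.mem_dP_iff.1 y.2
    have h1 : height (y : LTilde) + Real.log (minFn Γ₁ Γ₂ t φ (theta y)) = 0 := by
      rw [gauge] at hy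
      have := congrArg Real.log hy
      rwa [Real.log_mul (Real.exp_pos _).ne' (hst.minFn_pos _).ne', Real.log_exp, Real.log_one]
        at this
    change scale (-Real.log (minFn Γ₁ Γ₂ t φ (theta y))) (theta (y : LTilde)) = y
    rw [← eq_neg_iff_add_eq_zero.2 h1, scale_theta]
  right_inv a := theta_scale _ a
  continuous_toFun := continuous_theta.comp continuous_subtype_val
  continuous_invFun := by
    refine Continuous.subtype_mk ?_ _
    exact continuous_scale.comp
      ((hst.continuous_minFn.log fun a => (hst.minFn_pos a).ne').neg.prodMk continuous_subtype_val)

theorem homeomorph_apply (hst : IsStep Γ₁ Γ₂ u t φ) (y : dP Γ₁ Γ₂ u) :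
    hst.homeomorph y = theta y := rfl

/-- Along a ray the weight and the gauge are multiplied by the same factor, so on `∂P` the equation
`weight = 1` compares the weight with the minimum on `G̃`. -/
theorem preimage_frontier_H (hst : IsStep Γ₁ Γ₂ u t φ) (g : GTilde) :
    (Subtype.val ⁻¹' (frontier (H g) ∩ dP Γ₁ Γ₂ u) : Set (dP Γ₁ Γ₂ u)) =
      hst.homeomorph ⁻¹' touch Γ₁ Γ₂ t φ g := by
  ext y
  have hy := hst.mem_dP_iff.1 y.2
  rw [gauge] at hy
  simp only [Set.mem_preimage, Set.mem_inter_iff, y.2, and_true, frontier_H, Set.mem_ofPred_eq,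
    touch, homeomorph_apply]
  rw [weight_eq_exp_mul]
  constructor
  · intro h
    exact mul_left_cancel₀ (Real.exp_pos _).ne' (h.trans hy.symm)
  · intro h
    rw [h, hy]

theorem F_eq (hst : IsStep Γ₁ Γ₂ u t φ) (g : GTilde) :
    F Γ₁ Γ₂ u g =
      Subtype.val '' (hst.homeomorph ⁻¹' closure (interior (touch Γ₁ Γ₂ t φ g))) := by
  rw [F, closureIn, interiorIn, preimage_frontier_H hst,
    Set.preimage_image_eq _ Subtype.val_injective, hst.homeomorph.preimage_closure,
    hst.homeomorph.preimage_interior]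

theorem calF_eq (hst : IsStep Γ₁ Γ₂ u t φ) (g : GTilde) :
    calF Γ₁ Γ₂ u g = closure (interior (touch Γ₁ Γ₂ t φ g)) := by
  rw [calF, hst.F_eq, Set.image_image]
  exact Set.image_preimage_eq _ hst.homeomorph.surjective

theorem preimage_F (hst : IsStep Γ₁ Γ₂ u t φ) (g : GTilde) :
    (Subtype.val ⁻¹' F Γ₁ Γ₂ u g : Set (dP Γ₁ Γ₂ u)) = hst.homeomorph ⁻¹' calF Γ₁ Γ₂ u g := by
  rw [hst.F_eq, hst.calF_eq, Set.preimage_image_eq _ Subtype.val_injective]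

theorem smul_touch (hst : IsStep Γ₁ Γ₂ u t φ) {γ : GTilde × GTilde} (hγ : γ ∈ Γ₁.prod Γ₂)
    (g : GTilde) : γ • touch Γ₁ Γ₂ t φ g = touch Γ₁ Γ₂ t φ (γ • g) := by
  ext a
  rw [Set.mem_smul_set_iff_inv_smul_mem]
  obtain ⟨b, rfl⟩ : ∃ b, γ • b = a := ⟨γ⁻¹ • a, smul_inv_smul _ _⟩
  rw [inv_smul_smul, touch, touch, Set.mem_ofPred_eq, Set.mem_ofPred_eq, hst.minFn_smul hγ,
    coe_smul_GTilde γ b, weight_smul]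

theorem smul_calF (hst : IsStep Γ₁ Γ₂ u t φ) {γ : GTilde × GTilde} (hγ : γ ∈ Γ₁.prod Γ₂)
    (g : GTilde) : γ • calF Γ₁ Γ₂ u g = calF Γ₁ Γ₂ u (γ • g) := by
  rw [hst.calF_eq, hst.calF_eq, ← hst.smul_touch hγ, interior_smul, closure_smul]

theorem mem_F_iff (hst : IsStep Γ₁ Γ₂ u t φ) {g : GTilde} {y : LTilde} :
    y ∈ F Γ₁ Γ₂ u g ↔ y ∈ dP Γ₁ Γ₂ u ∧ theta y ∈ calF Γ₁ Γ₂ u g := by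
  rw [hst.F_eq, hst.calF_eq]
  constructor
  · rintro ⟨x, hx, rfl⟩
    exact ⟨x.2, hx⟩
  · rintro ⟨hy, h⟩
    exact ⟨⟨y, hy⟩, h, rfl⟩

theorem smul_dP (hst : IsStep Γ₁ Γ₂ u t φ) {γ : GTilde × GTilde} (hγ : γ ∈ Γ₁.prod Γ₂) :
    γ • dP Γ₁ Γ₂ u = dP Γ₁ Γ₂ u := by
  ext y
  rw [Set.mem_smul_set_iff_inv_smul_mem]
  refine ⟨fun h => ?_, hst.smul_mem_dP (inv_mem hγ)⟩
  have := hst.smul_mem_dP hγ h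
  rwa [smul_inv_smul] at this

theorem smul_F (hst : IsStep Γ₁ Γ₂ u t φ) {γ : GTilde × GTilde} (hγ : γ ∈ Γ₁.prod Γ₂)
    (g : GTilde) : γ • F Γ₁ Γ₂ u g = F Γ₁ Γ₂ u (γ • g) := by
  ext y
  rw [Set.mem_smul_set_iff_inv_smul_mem, hst.mem_F_iff, hst.mem_F_iff, theta_smul,
    ← Set.mem_smul_set_iff_inv_smul_mem (a := γ) (A := dP Γ₁ Γ₂ u), hst.smul_dP hγ,
    ← Set.mem_smul_set_iff_inv_smul_mem, hst.smul_calF hγ]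

end IsStep

/-! ### Hyperplane sections of the quadric -/

theorem form_comm (a b : ℂ × ℂ) : form a b = form b a := by
  simp only [form, Complex.sub_re, Complex.mul_re, Complex.conj_re, Complex.conj_im]; ring

theorem form_add (a b c : ℂ × ℂ) : form a (b + c) = form a b + form a c := by
  simp only [form, Prod.fst_add, Prod.snd_add, map_add, Complex.sub_re, Complex.mul_re,
    Complex.conj_re, Complex.conj_im, Complex.add_re, Complex.add_im]; ring

theorem form_smul (a b : ℂ × ℂ) (s : ℝ) : form a (s • b) = s * form a b := by
  simp only [form, Prod.smul_fst, Prod.smul_snd, Complex.real_smul, map_mul, Complex.conj_ofReal,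
    Complex.sub_re, Complex.mul_re, Complex.mul_im, Complex.conj_re, Complex.conj_im,
    Complex.ofReal_re, Complex.ofReal_im]
  ring

theorem form_sub_left (a b c : ℂ × ℂ) : form (a - b) c = form a c - form b c := by
  simp only [form, Prod.fst_sub, Prod.snd_sub, Complex.sub_re, Complex.sub_im, Complex.mul_re,
    Complex.conj_re, Complex.conj_im]; ring

/-- The linear form `⟨a, ·⟩`. -/
def formL (a : ℂ × ℂ) : ℂ × ℂ →L[ℝ] ℝ :=
  LinearMap.toContinuousLinearMap
    { toFun := form a
      map_add' := form_add a
      map_smul' := fun s b => form_smul a b s }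

theorem form_self (g : GTilde) : form (g : LTilde).proj (g : LTilde).proj = -1 := by
  rw [form_coe_eq, inv_mul_cancel, one_w, Complex.one_re]

/-- The immersion of `G̃` into `ℂ²` in the chart `coord`. -/
def immersion (x : ℂ × ℝ) : ℂ × ℂ := (ofCoord x : LTilde).proj

theorem immersion_coord (g : GTilde) : immersion (coord g) = (g : LTilde).proj := by
  rw [immersion, ofCoord_coord]

theorem immersion_eq (x : ℂ × ℝ) : immersion x =
    (x.1, (Real.sqrt (1 + ‖x.1‖ ^ 2) : ℂ) * Complex.exp (x.2 * Complex.I)) := rfl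

theorem contDiff_immersion : ContDiff ℝ ∞ immersion := by
  have h : immersion = fun x : ℂ × ℝ =>
      (x.1, Real.sqrt (1 + ‖x.1‖ ^ 2) • Complex.exp ((x.2 : ℂ) * Complex.I)) := by
    funext x
    rw [immersion_eq, Complex.real_smul]
  rw [h]
  have h1 : ContDiff ℝ ∞ fun x : ℂ × ℝ => Real.sqrt (1 + ‖x.1‖ ^ 2) :=
    (contDiff_const.add (contDiff_fst.norm_sq ℝ)).sqrt fun x => by positivity
  have h2 : ContDiff ℝ ∞ fun x : ℂ × ℝ => ((x.2 : ℂ)) :=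
    Complex.ofRealCLM.contDiff.comp contDiff_snd
  have h3 : ContDiff ℝ ∞ fun x : ℂ × ℝ => Complex.exp ((x.2 : ℂ) * Complex.I) :=
    (h2.mul contDiff_const).cexp
  exact contDiff_fst.prodMk (h1.smul h3)

/-- The linear form `⟨v, ·⟩` on `G̃`, in the chart `coord`. -/
def chartForm (v : ℂ × ℂ) (x : ℂ × ℝ) : ℝ := form v (immersion x)

theorem contDiff_chartForm (v : ℂ × ℂ) : ContDiff ℝ ∞ (chartForm v) :=
  (formL v).contDiff.comp contDiff_immersion

theorem differentiable_chartForm (v : ℂ × ℂ) : Differentiable ℝ (chartForm v) :=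
  (contDiff_chartForm v).differentiable (by simp)

theorem chartForm_eq (v : ℂ × ℂ) (x : ℂ × ℝ) : chartForm v x =
    v.1.re * x.1.re + v.1.im * x.1.im - Real.sqrt (1 + (x.1.re * x.1.re + x.1.im * x.1.im)) *
      (v.2.re * Real.cos x.2 + v.2.im * Real.sin x.2) := by
  rw [chartForm, immersion_eq, ← Complex.normSq_eq_norm_sq, Complex.normSq_apply]
  simp only [form, Complex.sub_re, Complex.mul_re, Complex.mul_im, Complex.conj_re, Complex.conj_im,
    Complex.ofReal_re, Complex.ofReal_im, Complex.exp_ofReal_mul_I_re, Complex.exp_ofReal_mul_I_im]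
  ring

theorem fderiv_chartForm_apply {v : ℂ × ℂ} {x ξ : ℂ × ℝ} {d : ℝ}
    (h : HasDerivAt (fun s : ℝ => chartForm v (x + s • ξ)) d 0) :
    fderiv ℝ (chartForm v) x ξ = d := by
  rw [← (differentiable_chartForm v x).lineDeriv_eq_fderiv]
  exact HasLineDerivAt.lineDeriv h

/-- At a critical point `v` is orthogonal to the tangent space of the quadric, and `⟨v, x⟩ = 0`
makes it orthogonal to the position vector too. Together these span `ℂ²`, so `v = 0`. -/
theorem fderiv_chartForm_ne_zero {v : ℂ × ℂ} (hv : v ≠ 0) {x : ℂ × ℝ} (hx : chartForm v x = 0) :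
    fderiv ℝ (chartForm v) x ≠ 0 := by
  intro h0
  obtain ⟨⟨a, b⟩, α⟩ := x
  obtain ⟨⟨v₁, v₂⟩, ⟨v₃, v₄⟩⟩ := v
  have hr : 0 < Real.sqrt (1 + (a * a + b * b)) :=
    Real.sqrt_pos.2 (by nlinarith [mul_self_nonneg a, mul_self_nonneg b])
  have hr2 : Real.sqrt (1 + (a * a + b * b)) ^ 2 = 1 + (a * a + b * b) :=
    Real.sq_sqrt (by nlinarith [mul_self_nonneg a, mul_self_nonneg b])
  have e1 : HasDerivAt (fun s : ℝ => a + s) 1 0 := (hasDerivAt_id (0 : ℝ)).const_add a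
  have e2 : HasDerivAt (fun s : ℝ => b + s) 1 0 := (hasDerivAt_id (0 : ℝ)).const_add b
  have e3 : HasDerivAt (fun s : ℝ => α + s) 1 0 := (hasDerivAt_id (0 : ℝ)).const_add α
  have d1 : fderiv ℝ (chartForm (⟨v₁, v₂⟩, ⟨v₃, v₄⟩)) (⟨a, b⟩, α) (1, 0) =
      v₁ - (a / Real.sqrt (1 + (a * a + b * b))) * (v₃ * Real.cos α + v₄ * Real.sin α) := by
    apply fderiv_chartForm_apply
    have h := (((e1.const_mul v₁).add_const (v₂ * b)).sub
      ((((e1.mul e1).add_const (b * b)).const_add 1).sqrt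
        (by simp only [Pi.mul_apply, add_zero]; intro h; rw [h, Real.sqrt_zero] at hr; exact hr.false)
        |>.mul_const (v₃ * Real.cos α + v₄ * Real.sin α)))
    refine (h.congr_of_eventuallyEq (Filter.Eventually.of_forall fun s => ?_)).congr_deriv ?_
    · simp [chartForm_eq]
    · simp only [Pi.mul_apply, add_zero]
      field_simp
      ring
  have d2 : fderiv ℝ (chartForm (⟨v₁, v₂⟩, ⟨v₃, v₄⟩)) (⟨a, b⟩, α) (Complex.I, 0) =
      v₂ - (b / Real.sqrt (1 + (a * a + b * b))) * (v₃ * Real.cos α + v₄ * Real.sin α) := by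
    apply fderiv_chartForm_apply
    have h := (((e2.const_mul v₂).const_add (v₁ * a)).sub
      ((((e2.mul e2).const_add (a * a)).const_add 1).sqrt
        (by simp only [Pi.mul_apply, add_zero]; intro h; rw [h, Real.sqrt_zero] at hr; exact hr.false)
        |>.mul_const (v₃ * Real.cos α + v₄ * Real.sin α)))
    refine (h.congr_of_eventuallyEq (Filter.Eventually.of_forall fun s => ?_)).congr_deriv ?_
    · simp [chartForm_eq]
    · simp only [Pi.mul_apply, add_zero]
      field_simp
      ring
  have d3 : fderiv ℝ (chartForm (⟨v₁, v₂⟩, ⟨v₃, v₄⟩)) (⟨a, b⟩, α) (0, 1) =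
      -(Real.sqrt (1 + (a * a + b * b)) * (-(v₃ * Real.sin α) + v₄ * Real.cos α)) := by
    apply fderiv_chartForm_apply
    have h := (((e3.cos.const_mul v₃).add (e3.sin.const_mul v₄)).const_mul
      (Real.sqrt (1 + (a * a + b * b)))).const_sub (v₁ * a + v₂ * b)
    refine (h.congr_of_eventuallyEq (Filter.Eventually.of_forall fun s => ?_)).congr_deriv ?_
    · simp [chartForm_eq]
    · simp
  rw [h0, zero_apply] at d1 d2 d3
  rw [chartForm_eq] at hx
  simp only at hx
  set r := Real.sqrt (1 + (a * a + b * b))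
  set C := v₃ * Real.cos α + v₄ * Real.sin α with hC
  have h1 : v₁ = a / r * C := by linarith
  have h2 : v₂ = b / r * C := by linarith
  -- After substitution `⟨v, x⟩` becomes `C(a² + b² - r²)/r = -C/r`.
  have h3 : C = 0 := by
    rw [h1, h2] at hx
    field_simp at hx
    nlinarith
  have h4 : v₃ * Real.sin α = v₄ * Real.cos α := by
    have := (mul_eq_zero.1 (neg_eq_zero.1 d3.symm)).resolve_left hr.ne'
    linarith
  have h5 := Real.sin_sq_add_cos_sq α
  have h6 : v₃ = 0 := by
    linear_combination (-v₃) * h5 + Real.sin α * h4 + Real.cos α * (hC.symm.trans h3)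
  have h7 : v₄ = 0 := by
    linear_combination (-v₄) * h5 - Real.cos α * h4 + Real.sin α * (hC.symm.trans h3)
  rw [h3, mul_zero] at h1 h2
  apply hv
  rw [h1, h2, h6, h7]
  rfl

theorem eq_zero_of_form_eq_zero {v : ℂ × ℂ} {W : Set GTilde} (hW : IsOpen W) (hne : W.Nonempty)
    (h : ∀ a ∈ W, form v (a : LTilde).proj = 0) : v = 0 := by
  obtain ⟨a, ha⟩ := hne
  by_contra hv
  have h1 : ∀ b ∈ W, chartForm v (coord b) = 0 := fun b hb => by
    rw [chartForm, immersion_coord]; exact h b hb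
  refine fderiv_chartForm_ne_zero hv (h1 a ha) ?_
  have h2 : chartForm v =ᶠ[𝓝 (coord a)] fun _ => 0 := by
    have h3 : ofCoord ⁻¹' W ∈ 𝓝 (coord a) :=
      (hW.preimage continuous_ofCoord).mem_nhds (by rwa [Set.mem_preimage, ofCoord_coord])
    filter_upwards [h3] with x hx
    exact h1 _ hx
  rw [h2.fderiv_eq, fderiv_fun_const, Pi.zero_apply]

/-! ### Geodesics -/

/-- Grönwall's inequality for the first-order system of `(f, f₁)`, where `μ` is bounded on `[0, T]`.
-/
theorem eq_zero_of_second_order {f f₁ μ : ℝ → ℝ} (hf : ∀ t, HasDerivAt f (f₁ t) t)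
    (hf₁ : ∀ t, HasDerivAt f₁ (μ t * f t) t) (hμ : Continuous μ) (h0 : f 0 = 0) (h1 : f₁ 0 = 0)
    {T : ℝ} (hT : 0 ≤ T) : f T = 0 := by
  obtain ⟨K, hK⟩ := isCompact_Icc.exists_bound_of_continuousOn (s := Set.Icc 0 T) hμ.continuousOn
  have hd : ∀ t, HasDerivAt (fun t => (f t, f₁ t)) (f₁ t, μ t * f t) t :=
    fun t => (hf t).prodMk (hf₁ t)
  have h := eq_zero_of_abs_deriv_le_mul_abs_self_of_eq_zero_right (K := max 1 K)
    (f := fun t => (f t, f₁ t)) (a := 0) (b := T)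
    (fun t _ => (hd t).continuousAt.continuousWithinAt) (fun t _ => (hd t).hasDerivWithinAt)
    (by simp [h0, h1]) ?_ T ⟨hT, le_rfl⟩
  · exact congrArg Prod.fst h
  · intro t ht
    refine max_le ?_ ?_
    · calc ‖f₁ t‖ ≤ ‖(f t, f₁ t)‖ := norm_snd_le (f t, f₁ t)
        _ ≤ max 1 K * ‖(f t, f₁ t)‖ :=
          le_mul_of_one_le_left (norm_nonneg _) (le_max_left _ _)
    · change ‖μ t * f t‖ ≤ _
      rw [norm_mul]
      exact mul_le_mul ((hK t ⟨ht.1, ht.2.le⟩).trans (le_max_right _ _)) (norm_fst_le (f t, f₁ t))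
        (norm_nonneg _) (le_trans zero_le_one (le_max_left _ _))

theorem eq_zero_of_second_order' {f f₁ μ : ℝ → ℝ} (hf : ∀ t, HasDerivAt f (f₁ t) t)
    (hf₁ : ∀ t, HasDerivAt f₁ (μ t * f t) t) (hμ : Continuous μ) (h0 : f 0 = 0) (h1 : f₁ 0 = 0)
    (T : ℝ) : f T = 0 := by
  rcases le_total 0 T with hT | hT
  · exact eq_zero_of_second_order hf hf₁ hμ h0 h1 hT
  · have h := eq_zero_of_second_order (f := fun t => f (-t)) (f₁ := fun t => -f₁ (-t))
      (μ := fun t => μ (-t)) (T := -T) ?_ ?_ (hμ.comp continuous_neg) (by simpa using h0)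
      (by simpa using h1) (by linarith)
    · simpa using h
    · intro t
      exact ((hf (-t)).scomp t (hasDerivAt_neg t)).congr_deriv (by simp)
    · intro t
      exact ((hf₁ (-t)).scomp t (hasDerivAt_neg t)).neg.congr_deriv (by simp)

/-- The acceleration is normal to the quadric, hence `γ'' = μγ` with `μ = -⟨γ'', γ⟩`, and `f = ⟨v,
γ⟩` solves `f'' = μf` with zero initial data. -/
theorem IsGeodesic.form_eq_zero {c : ℝ → GTilde} (hc : IsGeodesic c) {v : ℂ × ℂ}
    (h0 : form v (c 0 : LTilde).proj = 0)
    (h1 : form v (deriv (fun t => (c t : LTilde).proj) 0) = 0) (T : ℝ) :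
    form v (c T : LTilde).proj = 0 := by
  set γ : ℝ → ℂ × ℂ := fun t => (c t : LTilde).proj with hγ
  have hγe : γ = fun t => immersion (coord (c t)) := funext fun t => (immersion_coord _).symm
  have hsm : ContDiff ℝ ∞ γ := by
    rw [hγe]; exact contDiff_immersion.comp hc.1
  have hsm1 : ContDiff ℝ ∞ (deriv γ) := ((contDiff_infty_iff_deriv).1 hsm).2
  have hsm2 : ContDiff ℝ ∞ (deriv (deriv γ)) := ((contDiff_infty_iff_deriv).1 hsm1).2
  have hd : ∀ t, HasDerivAt γ (deriv γ t) t := fun t =>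
    (hsm.differentiable (by simp) t).hasDerivAt
  have hd1 : ∀ t, HasDerivAt (deriv γ) (deriv (deriv γ) t) t := fun t =>
    (hsm1.differentiable (by simp) t).hasDerivAt
  have hacc : ∀ t, form v (deriv (deriv γ) t) =
      -form (deriv (deriv γ) t) (γ t) * form v (γ t) := by
    intro t
    -- This is the tangential part of `v`, because `⟨γ, γ⟩ = -1`.
    have h := hc.2 t (v + form (γ t) v • γ t) (by
      change form (γ t) _ = 0
      rw [form_add, form_smul, show form (γ t) (γ t) = -1 from form_self (c t)]; ring)
    rw [form_add, form_smul] at h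
    rw [form_comm v, form_comm v]
    linear_combination h
  have hcont : Continuous fun t => -form (deriv (deriv γ) t) (γ t) := by
    have h2 := hsm2.continuous
    have h3 := hsm.continuous
    unfold form
    fun_prop
  refine eq_zero_of_second_order' (f := fun t => form v (γ t)) (f₁ := fun t => form v (deriv γ t))
    (fun t => ?_) (fun t => ?_) hcont h0 h1 T
  · exact (formL v).hasFDerivAt.comp_hasDerivAt t (hd t)
  · rw [← hacc]
    exact (formL v).hasFDerivAt.comp_hasDerivAt t (hd1 t)

theorem isTotallyGeodesicSurface {v : ℂ × ℂ} (hv : v ≠ 0) :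
    IsTotallyGeodesicSurface {a : GTilde | form v (a : LTilde).proj = 0} := by
  have heq : ∀ q : GTilde, chartForm v (coord q) = form v (q : LTilde).proj := fun q => by
    rw [chartForm, immersion_coord]
  intro p hp
  refine ⟨{x | fderiv ℝ (chartForm v) x ≠ 0}, chartForm v, ?_,
    fderiv_chartForm_ne_zero hv ((heq p).trans hp), (contDiff_chartForm v).contDiffOn,
    fun x hx => hx, fun q _ => by rw [heq]; rfl, ?_⟩
  · exact isOpen_ne_fun ((contDiff_chartForm v).continuous_fderiv (by simp)) continuous_const
  · rintro c hc rfl hd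
    refine Filter.Eventually.of_forall fun t => hc.form_eq_zero hp ?_ t
    have h1 : HasDerivAt (fun t => coord (c t)) (deriv (fun t => coord (c t)) 0) 0 :=
      (hc.1.differentiable (by simp) 0).hasDerivAt
    have h2 := (differentiable_chartForm v (coord (c 0))).hasFDerivAt.comp_hasDerivAt (0 : ℝ) h1
    rw [hd] at h2
    have h3 : DifferentiableAt ℝ (fun t => (c t : LTilde).proj) 0 := by
      have : (fun t => (c t : LTilde).proj) = fun t => immersion (coord (c t)) :=
        funext fun t => (immersion_coord _).symm
      rw [this]
      exact (contDiff_immersion.comp hc.1).differentiable (by simp) 0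
    have h4 := (formL v).hasFDerivAt.comp_hasDerivAt (0 : ℝ) h3.hasDerivAt
    refine h4.unique ?_
    convert h2 using 1
    funext t
    exact (heq (c t)).symm

/-! ### Coincidence of truncated linear functions -/

/-- Both arguments lie in `(-π/2, π/2)`, so `g⁻¹a` and `h⁻¹a` are on the same sheet over one point.
-/
theorem eq_of_proj_eq {g h : GTilde} (hgh : (g : LTilde).proj = (h : LTilde).proj) {a : LTilde}
    (hg : 0 < weight ((g : LTilde)⁻¹ * a)) (hh : 0 < weight ((h : LTilde)⁻¹ * a)) : g = h := by
  have hz : (g : LTilde).z = (h : LTilde).z := congrArg Prod.fst hgh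
  have hw : (g : LTilde).w = (h : LTilde).w := congrArg Prod.snd hgh
  have h1 := abs_lt.1 (weight_pos_iff.1 hg)
  have h2 := abs_lt.1 (weight_pos_iff.1 hh)
  have e : (g : LTilde)⁻¹ * a = (h : LTilde)⁻¹ * a := by
    apply eq_of
    · rw [mul_z, mul_z, coe_inv_z, coe_inv_z, coe_inv_w, coe_inv_w, hz, hw]
    · rw [mul_w, mul_w, coe_inv_z, coe_inv_z, coe_inv_w, coe_inv_w, hz, hw]
    · rw [abs_lt]
      have := Real.pi_pos
      constructor <;> linarith
  exact Subtype.ext (inv_injective (mul_right_cancel e))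

theorem form_sub_eq_zero {g h : GTilde} {a : LTilde}
    (heq : weight ((g : LTilde)⁻¹ * a) = weight ((h : LTilde)⁻¹ * a))
    (hpos : 0 < weight ((g : LTilde)⁻¹ * a)) :
    form ((g : LTilde).proj - (h : LTilde).proj) a.proj = 0 := by
  have hpos' := hpos
  rw [heq] at hpos'
  rw [weight_of_lt (weight_pos_iff.1 hpos), weight_of_lt (weight_pos_iff.1 hpos')] at heq
  rw [form_sub_left, form_coe_eq, form_coe_eq, heq, sub_self]

theorem eq_of_weight_eqOn {g h : GTilde} {W : Set GTilde} (hW : IsOpen W) (hne : W.Nonempty)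
    (heq : ∀ a ∈ W, weight ((g : LTilde)⁻¹ * a) = weight ((h : LTilde)⁻¹ * a))
    (hpos : ∀ a ∈ W, 0 < weight ((g : LTilde)⁻¹ * a)) : g = h := by
  have h0 := eq_zero_of_form_eq_zero hW hne fun a ha => form_sub_eq_zero (heq a ha) (hpos a ha)
  obtain ⟨a, ha⟩ := hne
  exact eq_of_proj_eq (sub_eq_zero.1 h0) (hpos a ha) (heq a ha ▸ hpos a ha)

/-! ### Transport of fundamental domains -/

theorem closureIn_univ {M : Type*} [TopologicalSpace M] (A : Set M) :
    closureIn Set.univ A = closure A := by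
  rw [closureIn, ← isClosed_univ.isClosedEmbedding_subtypeVal.closure_image_eq,
    Subtype.image_preimage_coe, Set.univ_inter]

theorem interiorIn_univ {M : Type*} [TopologicalSpace M] (A : Set M) :
    interiorIn Set.univ A = interior A := by
  rw [interiorIn, ← isOpen_univ.isOpenMap_subtype_val.preimage_interior_eq_interior_preimage
    continuous_subtype_val, Subtype.image_preimage_coe, Set.univ_inter]

namespace IsFundamentalDomainMod

variable {A M M' : Type*} [Group A] [MulAction A M] [TopologicalSpace M] {Λ S S' : Subgroup A}
  {X D : Set M}

theorem of_stabilizer (h : IsFundamentalDomainMod Λ S X D) (h₁ : ∀ γ ∈ Λ, γ ∈ S → γ ∈ S')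
    (h₂ : ∀ γ ∈ Λ, γ ∈ S' → γ • D = D) : IsFundamentalDomainMod Λ S' X D where
  subset := h.subset
  closed := h.closed
  stable := h₂
  disjoint γ hγ hS := h.disjoint γ hγ fun h' => hS (h₁ γ hγ h')
  dense := h.dense
  cover := h.cover

/-- An element that fixes `X` pointwise fixes `D ⊆ X`, so only the triviality of the action of `Λ ∩
S` is needed. -/
theorem of_fixingSubgroup (h : IsFundamentalDomainMod Λ S X D)
    (h₁ : ∀ γ ∈ Λ, γ ∈ S → ∀ x : M, γ • x = x) :
    IsFundamentalDomainMod Λ (fixingSubgroup A X) X D := by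
  refine h.of_stabilizer (fun γ hγ hS => ?_) fun γ _ hfix => ?_
  · rw [mem_fixingSubgroup_iff]
    exact fun x _ => h₁ γ hγ hS x
  · rw [mem_fixingSubgroup_iff] at hfix
    change (fun x => γ • x) '' D = D
    rw [Set.image_congr fun x hx => hfix x (h.subset hx), Set.image_id']

theorem comap [MulAction A M'] [TopologicalSpace M'] {D' : Set M'}
    (h : IsFundamentalDomainMod Λ S Set.univ D') (e : X ≃ₜ M') {τ : M → M'}
    (he : ∀ x : X, e x = τ x) (hX : ∀ γ ∈ Λ, ∀ x ∈ X, γ • x ∈ X)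
    (hτ : ∀ γ ∈ Λ, ∀ x ∈ X, τ (γ • x) = γ • τ x) :
    IsFundamentalDomainMod Λ S X (Subtype.val '' (e ⁻¹' D')) := by
  have hmem : ∀ (B : Set M') (x : M), x ∈ Subtype.val '' (e ⁻¹' B) ↔ x ∈ X ∧ τ x ∈ B := by
    intro B x
    constructor
    · rintro ⟨y, hy, rfl⟩
      exact ⟨y.2, he y ▸ hy⟩
    · rintro ⟨hx, hB⟩
      refine ⟨⟨x, hx⟩, ?_, rfl⟩
      rw [Set.mem_preimage, he]
      exact hB
  have hcl : ∀ B : Set M', closureIn X (Subtype.val '' (e ⁻¹' B)) =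
      Subtype.val '' (e ⁻¹' closureIn Set.univ B) := by
    intro B
    rw [closureIn_univ, closureIn, Set.preimage_image_eq _ Subtype.val_injective,
      e.preimage_closure]
  have hint : ∀ B : Set M', interiorIn X (Subtype.val '' (e ⁻¹' B)) =
      Subtype.val '' (e ⁻¹' interiorIn Set.univ B) := by
    intro B
    rw [interiorIn_univ, interiorIn, Set.preimage_image_eq _ Subtype.val_injective,
      e.preimage_interior]
  have hsmul : ∀ γ ∈ Λ, ∀ B : Set M', γ • (Subtype.val '' (e ⁻¹' B)) =
      (Subtype.val '' (e ⁻¹' (γ • B)) : Set M) := by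
    intro γ hγ B
    ext x
    rw [Set.mem_smul_set_iff_inv_smul_mem, hmem, hmem, Set.mem_smul_set_iff_inv_smul_mem]
    constructor
    · rintro ⟨h1, h2⟩
      have h3 := hX γ hγ _ h1
      rw [smul_inv_smul] at h3
      exact ⟨h3, by rwa [← hτ _ (inv_mem hγ) x h3]⟩
    · rintro ⟨h1, h2⟩
      exact ⟨hX _ (inv_mem hγ) x h1, by rwa [hτ _ (inv_mem hγ) x h1]⟩
  have huniv : (Subtype.val '' (e ⁻¹' (Set.univ : Set M')) : Set M) = X := by
    rw [Set.preimage_univ, Set.image_univ, Subtype.range_val]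
  have hunion : ∀ B : A → Set M', (⋃ γ ∈ Λ, (Subtype.val '' (e ⁻¹' B γ) : Set M)) =
      Subtype.val '' (e ⁻¹' ⋃ γ ∈ Λ, B γ) := by
    intro B
    simp only [Set.preimage_iUnion, Set.image_iUnion]
  refine ⟨?_, ?_, fun γ hγ hS => ?_, fun γ hγ hS => ?_, ?_, ?_⟩
  · rintro _ ⟨y, -, rfl⟩
    exact y.2
  · rw [hcl, h.closed]
  · rw [hsmul γ hγ, h.stable γ hγ hS]
  · rw [hint, hsmul γ hγ, Set.disjoint_image_iff Subtype.val_injective]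
    exact (h.disjoint γ hγ hS).preimage e
  · rw [Set.iUnion₂_congr fun γ hγ => by rw [hsmul γ hγ, hint], hunion, hcl, h.dense, huniv]
  · rw [Set.iUnion₂_congr fun γ hγ => hsmul γ hγ D', hunion, h.cover, huniv]

end IsFundamentalDomainMod

/-! ### The facets -/

/-- The set of the points of `G̃` over which the boundary of the polytope lies in the facet that
belongs to `h`. -/
def facet (Γ₁ Γ₂ : Subgroup GTilde) (t : GTilde) (φ : ℝ) (h : GTilde) : Set GTilde :=
  {a | |((t : LTilde)⁻¹ * ((h : LTilde)⁻¹ * a) * t).arg| ≤ φ / 2 ∧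
    prismFn t φ ((h : LTilde)⁻¹ * a) ≤ minFn Γ₁ Γ₂ t φ a}

theorem mem_facet {Γ₁ Γ₂ : Subgroup GTilde} {t h a : GTilde} {φ : ℝ} :
    a ∈ facet Γ₁ Γ₂ t φ h ↔ a ∈ cell t φ (minFn Γ₁ Γ₂ t φ a) h := by
  rw [facet, cell, Set.mem_ofPred_eq, Set.mem_ofPred_eq]

namespace IsStep

variable {Γ₁ Γ₂ : Subgroup GTilde} {u : 𝔻} {t : GTilde} {φ : ℝ}

theorem isClosed_facet (hst : IsStep Γ₁ Γ₂ u t φ) (h : GTilde) :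
    IsClosed (facet Γ₁ Γ₂ t φ h) :=
  (isClosed_le (continuous_conj_arg_coe t h).abs continuous_const).inter
    (isClosed_le (continuous_prismFn_coe t h φ) hst.continuous_minFn)

theorem iUnion_facet (hst : IsStep Γ₁ Γ₂ u t φ) :
    ⋃ h : products Γ₁ Γ₂, facet Γ₁ Γ₂ t φ h = Set.univ := by
  refine Set.eq_univ_of_forall fun a => ?_
  obtain ⟨h, hh, hmem⟩ := hst.exists_minFn_eq a
  exact Set.mem_iUnion_of_mem (⟨h, hh⟩ : products Γ₁ Γ₂) (mem_facet.2 hmem)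

/-- Near `a` the minimum stays below its value at `a` plus one, so there the facets lie in the cells
of that level. -/
theorem locallyFinite_facet (hst : IsStep Γ₁ Γ₂ u t φ) :
    LocallyFinite fun h : products Γ₁ Γ₂ => facet Γ₁ Γ₂ t φ h := by
  intro a
  obtain ⟨U, hU, hfin⟩ := hst.locallyFinite_cell (minFn Γ₁ Γ₂ t φ a + 1) a
  have hV : ∀ᶠ b in 𝓝 a, minFn Γ₁ Γ₂ t φ b < minFn Γ₁ Γ₂ t φ a + 1 :=
    hst.continuous_minFn.continuousAt.eventually_lt_const (lt_add_one _)
  refine ⟨_, Filter.inter_mem hU hV, hfin.subset ?_⟩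
  rintro h ⟨b, hb, hbU, hbV⟩
  exact ⟨b, ⟨hb.1, hb.2.trans (le_of_lt hbV)⟩, hbU⟩

/-- Over the facet the prism function is the weight of `h` itself. -/
theorem facet_subset_touch (hst : IsStep Γ₁ Γ₂ u t φ) {h : GTilde} (hh : h ∈ products Γ₁ Γ₂) :
    facet Γ₁ Γ₂ t φ h ⊆ touch Γ₁ Γ₂ t φ h := by
  intro a ha
  have h1 := prismFn_eq_weight hst.pos hst.lt_pi ha.1
  exact h1.symm.trans (le_antisymm ha.2 (hst.minFn_le hh a))

theorem isClosed_touch (hst : IsStep Γ₁ Γ₂ u t φ) (h : GTilde) :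
    IsClosed (touch Γ₁ Γ₂ t φ h) :=
  isClosed_eq (continuous_weight_coe h) hst.continuous_minFn

theorem eq_of_isOpen_subset_touch (hst : IsStep Γ₁ Γ₂ u t φ) {g h : GTilde} {W : Set GTilde}
    (hW : IsOpen W) (hne : W.Nonempty) (hg : W ⊆ touch Γ₁ Γ₂ t φ g)
    (hh : W ⊆ touch Γ₁ Γ₂ t φ h) : g = h :=
  eq_of_weight_eqOn hW hne (fun _ ha => (hg ha).trans (hh ha).symm)
    fun a ha => (hst.minFn_pos a).trans_eq (hg ha).symm

theorem countable_products (hst : IsStep Γ₁ Γ₂ u t φ) : (products Γ₁ Γ₂).Countable := by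
  have h : products Γ₁ Γ₂ = ⋃ n, products Γ₁ Γ₂ ∩ compactCovering GTilde n := by
    rw [← Set.inter_iUnion, iUnion_compactCovering, Set.inter_univ]
  rw [h]
  exact Set.countable_iUnion fun n =>
    (hst.finite _ (isCompact_compactCovering GTilde n)).countable

/-- Baire's theorem for a countable closed cover. -/
theorem dense_interior_facet (hst : IsStep Γ₁ Γ₂ u t φ) :
    Dense (⋃ h : products Γ₁ Γ₂, interior (facet Γ₁ Γ₂ t φ h)) := by
  have := hst.countable_products.to_subtype
  exact dense_iUnion_interior_of_closed (fun h => hst.isClosed_facet h) hst.iUnion_facet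

theorem calF_subset_touch (hst : IsStep Γ₁ Γ₂ u t φ) (g : GTilde) :
    calF Γ₁ Γ₂ u g ⊆ touch Γ₁ Γ₂ t φ g := by
  rw [hst.calF_eq]
  exact closure_minimal interior_subset (hst.isClosed_touch g)

theorem calF_subset_facet (hst : IsStep Γ₁ Γ₂ u t φ) (g : GTilde) :
    calF Γ₁ Γ₂ u g ⊆ facet Γ₁ Γ₂ t φ g := by
  rw [hst.calF_eq]
  refine closure_minimal ?_ (hst.isClosed_facet g)
  refine (hst.dense_interior_facet.open_subset_closure_inter isOpen_interior).trans
    (closure_minimal ?_ (hst.isClosed_facet g))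
  rintro a ⟨ha, ha'⟩
  obtain ⟨h, hh⟩ := Set.mem_iUnion.1 ha'
  -- On this open set the weights of `g` and `h` both equal the minimum, so the only facet whose
  -- interior meets the interior of `touch g` is that of `g`.
  have e : g = h := hst.eq_of_isOpen_subset_touch
    (W := interior (touch Γ₁ Γ₂ t φ g) ∩ interior (facet Γ₁ Γ₂ t φ h))
    (isOpen_interior.inter isOpen_interior) ⟨a, ha, hh⟩
    (Set.inter_subset_left.trans interior_subset)
    (Set.inter_subset_right.trans (interior_subset.trans (hst.facet_subset_touch h.2)))
  rw [e]
  exact interior_subset hh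

theorem locallyFinite_calF (hst : IsStep Γ₁ Γ₂ u t φ) :
    LocallyFinite fun g : products Γ₁ Γ₂ => calF Γ₁ Γ₂ u g :=
  hst.locallyFinite_facet.subset fun g => hst.calF_subset_facet g

theorem isClosed_calF (hst : IsStep Γ₁ Γ₂ u t φ) (g : GTilde) : IsClosed (calF Γ₁ Γ₂ u g) := by
  rw [hst.calF_eq]
  exact isClosed_closure

theorem interior_facet_subset (hst : IsStep Γ₁ Γ₂ u t φ) {h : GTilde} (hh : h ∈ products Γ₁ Γ₂) :
    interior (facet Γ₁ Γ₂ t φ h) ⊆ interior (calF Γ₁ Γ₂ u h) := by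
  refine interior_maximal ?_ isOpen_interior
  rw [hst.calF_eq]
  exact (interior_mono (hst.facet_subset_touch hh)).trans subset_closure

/-- The union is closed by local finiteness and contains the dense union of the interiors of the
facets. -/
theorem iUnion_calF (hst : IsStep Γ₁ Γ₂ u t φ) :
    ⋃ g : products Γ₁ Γ₂, calF Γ₁ Γ₂ u g = Set.univ := by
  have h1 : IsClosed (⋃ g : products Γ₁ Γ₂, calF Γ₁ Γ₂ u g) :=
    hst.locallyFinite_calF.isClosed_iUnion fun g => hst.isClosed_calF g
  rw [← h1.closure_eq]
  exact (hst.dense_interior_facet.mono (Set.iUnion_mono fun h =>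
    (hst.interior_facet_subset h.2).trans interior_subset)).closure_eq

theorem disjoint_interior_calF (hst : IsStep Γ₁ Γ₂ u t φ) {g h : GTilde} (hgh : h ≠ g) :
    Disjoint (interior (calF Γ₁ Γ₂ u g)) (calF Γ₁ Γ₂ u h) := by
  rw [Set.disjoint_left]
  intro a ha ha'
  rw [hst.calF_eq h] at ha'
  refine hgh (hst.eq_of_isOpen_subset_touch (isOpen_interior.inter isOpen_interior)
    (mem_closure_iff.1 ha' _ isOpen_interior ha) ?_ ?_).symm
  · exact Set.inter_subset_left.trans (interior_subset.trans (hst.calF_subset_touch g))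
  · exact Set.inter_subset_right.trans interior_subset

theorem isFundamentalDomainMod_calF (hst : IsStep Γ₁ Γ₂ u t φ) {g : GTilde}
    (hg : g ∈ products Γ₁ Γ₂) :
    IsFundamentalDomainMod (Γ₁.prod Γ₂) (MulAction.stabilizer (GTilde × GTilde) g) Set.univ
      (calF Γ₁ Γ₂ u g) where
  subset := Set.subset_univ _
  closed := by rw [closureIn_univ, (hst.isClosed_calF g).closure_eq]
  stable γ hγ hS := by rw [hst.smul_calF hγ, MulAction.mem_stabilizer_iff.1 hS]
  disjoint γ hγ hS := by
    rw [interiorIn_univ, hst.smul_calF hγ]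
    exact hst.disjoint_interior_calF fun h => hS (MulAction.mem_stabilizer_iff.2 h)
  dense := by
    rw [closureIn_univ]
    refine (hst.dense_interior_facet.mono (Set.iUnion_subset fun h => ?_)).closure_eq
    obtain ⟨γ, hγ, e⟩ := exists_smul_eq hg h.2
    refine Set.subset_iUnion₂_of_subset γ hγ ?_
    rw [interiorIn_univ, hst.smul_calF hγ, e]
    exact hst.interior_facet_subset h.2
  cover := by
    rw [← Set.univ_subset_iff, ← hst.iUnion_calF]
    refine Set.iUnion_subset fun h => ?_
    obtain ⟨γ, hγ, e⟩ := exists_smul_eq hg h.2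
    refine Set.subset_iUnion₂_of_subset γ hγ ?_
    rw [hst.smul_calF hγ, e]

theorem isFundamentalDomainMod_F (hst : IsStep Γ₁ Γ₂ u t φ) {g : GTilde}
    (hg : g ∈ products Γ₁ Γ₂) :
    IsFundamentalDomainMod (Γ₁.prod Γ₂) (MulAction.stabilizer (GTilde × GTilde) g) (dP Γ₁ Γ₂ u)
      (F Γ₁ Γ₂ u g) := by
  rw [hst.F_eq, ← hst.calF_eq]
  exact (hst.isFundamentalDomainMod_calF hg).comap hst.homeomorph (τ := theta)
    hst.homeomorph_apply (fun γ hγ x hx => hst.smul_mem_dP hγ hx) fun γ _ x _ => theta_smul γ x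

theorem exists_surface (hst : IsStep Γ₁ Γ₂ u t φ) {g h : GTilde} (hgh : g ≠ h) :
    ∃ N : Set GTilde, IsTotallyGeodesicSurface N ∧ calF Γ₁ Γ₂ u g ∩ calF Γ₁ Γ₂ u h ⊆ N := by
  have hg : ∀ a ∈ calF Γ₁ Γ₂ u g, 0 < weight ((g : LTilde)⁻¹ * a) := fun a ha =>
    (hst.minFn_pos a).trans_eq (hst.calF_subset_touch g ha).symm
  have hh : ∀ a ∈ calF Γ₁ Γ₂ u h, 0 < weight ((h : LTilde)⁻¹ * a) := fun a ha =>
    (hst.minFn_pos a).trans_eq (hst.calF_subset_touch h ha).symm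
  by_cases hv : (g : LTilde).proj - (h : LTilde).proj = 0
  -- If `g` and `h` lie over the same matrix, the two sets are disjoint and any surface will do.
  · refine ⟨_, isTotallyGeodesicSurface (v := (1, 0)) (by simp), ?_⟩
    rintro a ⟨hag, hah⟩
    exact absurd (eq_of_proj_eq (sub_eq_zero.1 hv) (hg a hag) (hh a hah)) hgh
  · refine ⟨_, isTotallyGeodesicSurface hv, ?_⟩
    rintro a ⟨hag, hah⟩
    exact form_sub_eq_zero
      ((hst.calF_subset_touch g hag).trans (hst.calF_subset_touch h hah).symm) (hg a hag)

end IsStep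

/-- If `Γ₁ ∩ Γ₂` is central, then the elements of `Γ₁ × Γ₂` that fix a point of `Γ₁Γ₂` act
trivially. -/
theorem smul_eq_self_of_stabilizer {Γ₁ Γ₂ : Subgroup GTilde} (hZ : Γ₁ ⊓ Γ₂ ≤ Z) {g : GTilde}
    (hg : g ∈ products Γ₁ Γ₂) {γ : GTilde × GTilde} (hγ : γ ∈ Γ₁.prod Γ₂)
    (hS : γ ∈ MulAction.stabilizer (GTilde × GTilde) g) (y : LTilde) : γ • y = y := by
  obtain ⟨g₁, hg₁, g₂, hg₂, rfl⟩ := hg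
  obtain ⟨c, d⟩ := γ
  obtain ⟨hc, hd⟩ := Subgroup.mem_prod.1 hγ
  have h1 : c * (g₁ * g₂) * d⁻¹ = g₁ * g₂ := MulAction.mem_stabilizer_iff.1 hS
  -- The left side lies in `Γ₁` and the right side in `Γ₂`, so both are central; conjugation then
  -- has no effect and `c = d` is central.
  have h2 : g₁⁻¹ * c * g₁ = g₂ * d * g₂⁻¹ := by
    rw [mul_inv_eq_iff_eq_mul] at h1
    calc g₁⁻¹ * c * g₁ = g₁⁻¹ * (c * (g₁ * g₂)) * g₂⁻¹ := by group
      _ = g₂ * d * g₂⁻¹ := by rw [h1]; group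
  have h3 : g₁⁻¹ * c * g₁ ∈ Z := hZ ⟨Γ₁.mul_mem (Γ₁.mul_mem (Γ₁.inv_mem hg₁) hc) hg₁, by
    rw [h2]; exact Γ₂.mul_mem (Γ₂.mul_mem hg₂ hd) (Γ₂.inv_mem hg₂)⟩
  have h4 := Subgroup.mem_center_iff.1 h3
  have hcd : c = d := by
    have e1 : c = g₁⁻¹ * c * g₁ := by
      have := h4 g₁
      calc c = g₁ * (g₁⁻¹ * c * g₁) * g₁⁻¹ := by group
        _ = g₁⁻¹ * c * g₁ := by rw [this]; group
    have e2 : d = g₁⁻¹ * c * g₁ := by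
      have := h4 g₂⁻¹
      calc d = g₂⁻¹ * (g₂ * d * g₂⁻¹) * g₂ := by group
        _ = g₁⁻¹ * c * g₁ := by rw [← h2, this]; group
    rw [e1, ← e2]
  have hcZ : c ∈ Z := by
    have := (inferInstance : Z.Normal).conj_mem _ h3 g₁
    rwa [show g₁ * (g₁⁻¹ * c * g₁) * g₁⁻¹ = c by group] at this
  obtain ⟨n, rfl⟩ := mem_Z_iff.1 hcZ
  rw [smul_LTilde, ← hcd, rot_int_mul_pi_mul, mul_inv_cancel_right]

end LorentzDomains

end

/-! ### Assembly of the theorem -/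

theorem theoremA (Γ₁ Γ₂ : Subgroup LorentzDomains.GTilde) (u : Complex.UnitDisc) (k : ℕ)
    (hstar : LorentzDomains.ConditionStar Γ₁ Γ₂ u k) :
    -- the boundary of `P` is invariant
    (∀ γ ∈ Γ₁.prod Γ₂, γ • LorentzDomains.dP Γ₁ Γ₂ u = LorentzDomains.dP Γ₁ Γ₂ u) ∧
    -- the translates of `F_g` are the sets `F_{g₁ g g₂⁻¹}`
    (∀ γ ∈ Γ₁.prod Γ₂, ∀ g : LorentzDomains.GTilde,
      γ • LorentzDomains.F Γ₁ Γ₂ u g = LorentzDomains.F Γ₁ Γ₂ u (γ • g)) ∧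
    -- `F_g` is a fundamental domain on the boundary of `P`
    (∀ g ∈ LorentzDomains.products Γ₁ Γ₂,
      LorentzDomains.IsFundamentalDomainMod (Γ₁.prod Γ₂)
        (MulAction.stabilizer (LorentzDomains.GTilde × LorentzDomains.GTilde) g)
        (LorentzDomains.dP Γ₁ Γ₂ u) (LorentzDomains.F Γ₁ Γ₂ u g)) ∧
    (Γ₁ ⊓ Γ₂ ≤ LorentzDomains.Z → ∀ g ∈ LorentzDomains.products Γ₁ Γ₂,
      LorentzDomains.IsFundamentalDomainMod (Γ₁.prod Γ₂)
        (fixingSubgroup (LorentzDomains.GTilde × LorentzDomains.GTilde)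
          (LorentzDomains.dP Γ₁ Γ₂ u))
        (LorentzDomains.dP Γ₁ Γ₂ u) (LorentzDomains.F Γ₁ Γ₂ u g)) ∧
    -- the family of the sets `F_{g₁g₂}` is locally finite in the boundary of `P`
    LocallyFinite (fun g : LorentzDomains.products Γ₁ Γ₂ =>
      (Subtype.val ⁻¹' LorentzDomains.F Γ₁ Γ₂ u g : Set (LorentzDomains.dP Γ₁ Γ₂ u))) ∧
    -- the projection is an equivariant homeomorphism from the boundary of `P` onto `G̃`
    IsHomeomorph (fun a : LorentzDomains.dP Γ₁ Γ₂ u => LorentzDomains.theta a) ∧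
    (∀ γ ∈ Γ₁.prod Γ₂, ∀ a ∈ LorentzDomains.dP Γ₁ Γ₂ u,
      LorentzDomains.theta (γ • a) = γ • LorentzDomains.theta a) ∧
    -- the image of `F_g` is a fundamental domain on `G̃`
    (∀ g ∈ LorentzDomains.products Γ₁ Γ₂,
      LorentzDomains.IsFundamentalDomainMod (Γ₁.prod Γ₂)
        (MulAction.stabilizer (LorentzDomains.GTilde × LorentzDomains.GTilde) g)
        Set.univ (LorentzDomains.calF Γ₁ Γ₂ u g)) ∧
    (Γ₁ ⊓ Γ₂ ≤ LorentzDomains.Z → ∀ g ∈ LorentzDomains.products Γ₁ Γ₂,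
      LorentzDomains.IsFundamentalDomainMod (Γ₁.prod Γ₂)
        (fixingSubgroup (LorentzDomains.GTilde × LorentzDomains.GTilde)
          (Set.univ : Set LorentzDomains.GTilde))
        Set.univ (LorentzDomains.calF Γ₁ Γ₂ u g)) ∧
    -- the family of these images is locally finite
    LocallyFinite (fun g : LorentzDomains.products Γ₁ Γ₂ => LorentzDomains.calF Γ₁ Γ₂ u g) ∧
    -- two distinct members of the family meet inside a totally geodesic surface
    (∀ g₁ ∈ Γ₁, ∀ h₁ ∈ Γ₁, ∀ g₂ ∈ Γ₂, ∀ h₂ ∈ Γ₂, g₁ * g₂ ≠ h₁ * h₂ →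
      ∃ N : Set LorentzDomains.GTilde, LorentzDomains.IsTotallyGeodesicSurface N ∧
        LorentzDomains.calF Γ₁ Γ₂ u (g₁ * g₂) ∩ LorentzDomains.calF Γ₁ Γ₂ u (h₁ * h₂) ⊆ N) := by
  obtain ⟨t, φ, hst⟩ := hstar.exists_isStep
  refine ⟨fun γ hγ => hst.smul_dP hγ, fun γ hγ g => hst.smul_F hγ g,
    fun g hg => hst.isFundamentalDomainMod_F hg, fun hZ g hg => ?_, ?_,
    hst.homeomorph.isHomeomorph, fun γ _ a _ => LorentzDomains.theta_smul γ a,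
    fun g hg => hst.isFundamentalDomainMod_calF hg, fun hZ g hg => ?_, hst.locallyFinite_calF,
    fun g₁ _ h₁ _ g₂ _ h₂ _ hne => hst.exists_surface hne⟩
  · exact (hst.isFundamentalDomainMod_F hg).of_fixingSubgroup fun γ hγ hS =>
      LorentzDomains.smul_eq_self_of_stabilizer hZ hg hγ hS
  · simp only [hst.preimage_F]
    exact hst.locallyFinite_calF.preimage_continuous hst.homeomorph.continuous
  · exact (hst.isFundamentalDomainMod_calF hg).of_fixingSubgroup fun γ hγ hS x =>
      Subtype.ext (LorentzDomains.smul_eq_self_of_stabilizer hZ hg hγ hS x)
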